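/- For $n,w\in\mathbb N$, a unit weighing matrix $UW(n,w)$ is a complex $n\times n$ matrix $W$ all of whose entries are $0$ or unimodular (of absolute value one) and which satisfies $WW^*=wI_n$. Two such matrices are equivalent if one is obtained from the other by finitely many operations of the following kinds: permuting the rows, permuting the columns, multiplying a row by a unimodular number, multiplying a column by a unimodular number. Let $a=e^{2\pi i/3}$, write $-$ for $-1$, and put $$W_5=\begin{pmatrix}1&1&1&1&0\\1&a&\overline a&0&1\\1&\overline a&0&a&\overline a\\1&0&a&\overline a&a\\0&1&\overline a&a&a\end{pmatrix},\qquad W_6=\begin{pmatrix}1&1&1&1&0&0\\1&a&\overline a&0&1&0\\1&\overline a&a&0&0&1\\1&0&0&-&-&-\\0&1&0&-&-\overline a&-a\\0&0&1&-&-a&-\overline a\end{pmatrix},$$ $$W_7=\begin{pmatrix}1&1&1&1&0&0&0\\1&-&0&0&1&1&0\\1&0&-&0&-&0&1\\1&0&0&-&0&-&-\\0&1&-&0&0&1&-\\0&1&0&-&1&0&1\\0&0&1&-&-&1&0\end{pmatrix},\qquad W_8=\begin{pmatrix}1&1&1&1&0&0&0&0\\1&-&0&0&1&1&0&0\\1&0&-&0&-&0&1&0\\1&0&0&-&0&-&-&0\\0&1&-&0&1&0&0&1\\0&1&0&-&0&1&0&-\\0&0&1&-&0&0&1&1\\0&0&0&0&1&-&1&-\end{pmatrix}.$$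 For $m\ge2$ and unimodular $x$, let $E_{2m}(x)$ be the $2m\times2m$ matrix whose $2\times2$ cells $C_{pq}$ ($1\le p,q\le m$) are $$C_{11}=\begin{pmatrix}1&1\\1&1\end{pmatrix},\quad C_{p,p+1}=\begin{pmatrix}1&1\\-&-\end{pmatrix},\quad C_{p+1,p}=\begin{pmatrix}1&-\\1&-\end{pmatrix}\ (1\le p<m),\quad C_{mm}=\begin{pmatrix}x&-x\\-x&x\end{pmatrix},$$ all other cells being zero. Call $W_5,W_6,W_7,W_8$ and the $E_{2m}(x)$ ($m\ge2$, $x$ unimodular) blocks. A decomposition of $n$ is a way to write $n$ as an unordered sum of parts of the kinds $5^*,6^*,7^*,8^*$ (of sizes $5,6,7,8$, for the blocks $W_5,\dots,W_8$) and $2m$ with $m\ge2$ (for the family $E_{2m}$); the parts $6^*,8^*$ are distinct from the even parts $6,8$. Then: 1. Every direct sum of blocks of total order $n$ is a $UW(n,4)$, and every $UW(n,4)$ is equivalent to a direct sum of blocks. 2. A $UW(n,4)$ exists for every $n\ge4$. 3. The number of decompositions of $n$ is finite, and it bounds the number of inequivalent $UW(n,4)$ when each one-parameter family $E_{2m}(x)$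 is counted once. Precisely: (i) there is a set of at most as many sequences of kinds of blocks as there are decompositions of $n$, such that every $UW(n,4)$ is equivalent to a direct sum of blocks whose sequence of kinds belongs to this set (with suitable unimodular parameters $x$ in the blocks $E_{2m}(x)$); and (ii) the equivalence relation on the set of all $UW(n,4)$ that is generated by the above equivalence and by changing the parameters $x$ in a direct sum of blocks has finitely many classes, at most as many as there are decompositions of $n$. -/

import Mathlib

open Matrix

noncomputable section

namespace UnitWeighing

/-- A unit weighing matrix `UW(n, w)`: a complex `n × n` matrix whose entries are zero or
unimodular and which satisfies `W W* = w I`. -/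
def IsUW {n : ℕ} (w : ℕ) (W : Matrix (Fin n) (Fin n) ℂ) : Prop :=
  (∀ i j, W i j = 0 ∨ ‖W i j‖ = 1) ∧ W * Wᴴ = (w : ℂ) • (1 : Matrix (Fin n) (Fin n) ℂ)

/-- The elementary operations: permuting the rows, permuting the columns, multiplying one row
by a unimodular number, multiplying one column by a unimodular number. -/
inductive Step {n : ℕ} : Matrix (Fin n) (Fin n) ℂ → Matrix (Fin n) (Fin n) ℂ → Prop
  | permRows (W : Matrix (Fin n) (Fin n) ℂ) (σ : Equiv.Perm (Fin n)) :
      Step W (W.submatrix σ id)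
  | permCols (W : Matrix (Fin n) (Fin n) ℂ) (σ : Equiv.Perm (Fin n)) :
      Step W (W.submatrix id σ)
  | scaleRow (W : Matrix (Fin n) (Fin n) ℂ) (i : Fin n) (z : Circle) :
      Step W (W.updateRow i (fun j => (z : ℂ) * W i j))
  | scaleCol (W : Matrix (Fin n) (Fin n) ℂ) (j : Fin n) (z : Circle) :
      Step W (W.updateCol j (fun i => (z : ℂ) * W i j))

/-- Two matrices are equivalent if a finite number of elementary operations transforms the
first one into the second one. -/
def Equivalent {n : ℕ} (W W' : Matrix (Fin n) (Fin n) ℂ) : Prop :=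
  Relation.ReflTransGen Step W W'

/-- The primitive cube root of unity `e^{2πi/3}`. -/
def a : ℂ := Complex.exp (2 * Real.pi * Complex.I / 3)

/-- The complex conjugate of `a`. -/
def a' : ℂ := (starRingEnd ℂ) a

def W5 : Matrix (Fin 5) (Fin 5) ℂ :=
  !![1, 1,  1,  1,  0;
     1, a,  a', 0,  1;
     1, a', 0,  a,  a';
     1, 0,  a,  a', a;
     0, 1,  a', a,  a]

def W6 : Matrix (Fin 6) (Fin 6) ℂ :=
  !![1, 1,  1,  1,  0,   0;
     1, a,  a', 0,  1,   0;
     1, a', a,  0,  0,   1;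
     1, 0,  0,  -1, -1,  -1;
     0, 1,  0,  -1, -a', -a;
     0, 0,  1,  -1, -a,  -a']

def W7 : Matrix (Fin 7) (Fin 7) ℂ :=
  !![1, 1,  1,  1,  0,  0,  0;
     1, -1, 0,  0,  1,  1,  0;
     1, 0,  -1, 0,  -1, 0,  1;
     1, 0,  0,  -1, 0,  -1, -1;
     0, 1,  -1, 0,  0,  1,  -1;
     0, 1,  0,  -1, 1,  0,  1;
     0, 0,  1,  -1, -1, 1,  0]

def W8 : Matrix (Fin 8) (Fin 8) ℂ :=
  !![1, 1,  1,  1,  0,  0,  0,  0;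
     1, -1, 0,  0,  1,  1,  0,  0;
     1, 0,  -1, 0,  -1, 0,  1,  0;
     1, 0,  0,  -1, 0,  -1, -1, 0;
     0, 1,  -1, 0,  1,  0,  0,  1;
     0, 1,  0,  -1, 0,  1,  0,  -1;
     0, 0,  1,  -1, 0,  0,  1,  1;
     0, 0,  0,  0,  1,  -1, 1,  -1]

/-- The matrix `E_{2m}(x)` (for `m ≥ 2`).  Rows and columns are numbered from `0`; row `i` lies
in the row pair `i / 2` and column `j` in the column pair `j / 2`.  The `2 × 2` cell in row pair
`p` and column pair `q` is `(1 1; 1 1)` for `p = q = 0`, it is `(1 1; - -)` for `q = p + 1`, it is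
`(1 -; 1 -)` for `p = q + 1`, it is `(x -x; -x x)` for `p = q = m - 1`, and zero otherwise. -/
def E (m : ℕ) (x : Circle) : Matrix (Fin (2 * m)) (Fin (2 * m)) ℂ :=
  Matrix.of fun i j =>
    let p := i.val / 2
    let q := j.val / 2
    if p = 0 ∧ q = 0 then 1
    else if q = p + 1 then (-1) ^ i.val
    else if p = q + 1 then (-1) ^ j.val
    else if p = q ∧ p + 1 = m then (-1) ^ (i.val + j.val) * (x : ℂ)
    else 0

/-- The kinds of blocks: `W₅`, `W₆`, `W₇`, `W₈`, and, for every `m ≥ 2`, the family `E_{2m}`. -/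
inductive Kind
  | w5 | w6 | w7 | w8
  | e (m : ℕ) (hm : 2 ≤ m)

/-- The order of the blocks of a kind. -/
def Kind.order : Kind → ℕ
  | .w5 => 5
  | .w6 => 6
  | .w7 => 7
  | .w8 => 8
  | .e m _ => 2 * m

/-- The blocks: `W₅`, `W₆`, `W₇`, `W₈`, and `E_{2m}(x)` for `m ≥ 2` and `x` unimodular. -/
inductive Block
  | w5 | w6 | w7 | w8
  | e (m : ℕ) (hm : 2 ≤ m) (x : Circle)

/-- The kind of a block forgets the unimodular number in `E_{2m}(x)`. -/
def Block.kind : Block → Kind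
  | .w5 => .w5
  | .w6 => .w6
  | .w7 => .w7
  | .w8 => .w8
  | .e m hm _ => .e m hm

def Block.order (b : Block) : ℕ := b.kind.order

def Block.matrix : (b : Block) → Matrix (Fin b.order) (Fin b.order) ℂ
  | .w5 => W5
  | .w6 => W6
  | .w7 => W7
  | .w8 => W8
  | .e m _ x => E m x

/-- The sum of the orders of a list of blocks. -/
def totalOrder : List Block → ℕ
  | [] => 0
  | b :: l => b.order + totalOrder l

/-- The block diagonal matrix with the blocks of the list, in this order, along the diagonal. -/
def diagSum : (l : List Block) → Matrix (Fin (totalOrder l)) (Fin (totalOrder l)) ℂ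
  | [] => 0
  | b :: l => Matrix.reindex finSumFinEquiv finSumFinEquiv
      (Matrix.fromBlocks b.matrix 0 0 (diagSum l))

/-- The direct sum of a list of blocks of total order `n`, as an `n × n` matrix. -/
def directSum {n : ℕ} (l : List Block) (h : totalOrder l = n) : Matrix (Fin n) (Fin n) ℂ :=
  Matrix.reindex (finCongr h) (finCongr h) (diagSum l)

/-- The decompositions of `n` (as an unordered sum) into parts `5*`, `6*`, `7*`, `8*` and
`2m`, `m ≥ 2`, where the starred parts `6*`, `8*` are distinct from the even parts `6`, `8`. -/
def Decomposition (n : ℕ) : Type :=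
  {s : Multiset Kind // (s.map Kind.order).sum = n}

/-- The equivalence relation on the `UW(n, 4)` generated by equivalence of matrices and by changes
of the unimodular numbers `x` in the blocks `E_{2m}(x)` of a direct sum of blocks. -/
def familySetoid (n : ℕ) : Setoid {W : Matrix (Fin n) (Fin n) ℂ // IsUW 4 W} :=
  Relation.EqvGen.setoid fun W W' =>
    Equivalent W.1 W'.1 ∨
      ∃ (l l' : List Block) (h : totalOrder l = n) (h' : totalOrder l' = n),
        l.map Block.kind = l'.map Block.kind ∧ W.1 = directSum l h ∧ W'.1 = directSum l' h'

end UnitWeighing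

end

/-!
# Unit weighing matrices of weight four

Two distinct rows of a `UW(n, 4)` share zero, two, three or four columns: a vanishing sum of two
unimodular numbers has the form `z + (-z)`, one of three has the form `z + a z + a' z`, and a
single unimodular number is nonzero.  The same holds for the columns, as `W* W = 4 I`.  Everything
is derived from this local information; the conditions are packaged in `IsWeighing`, which is
symmetric under transposition and allows arbitrary index types.

The main point is `IsWeighing.contains_block`: up to scaling, some submatrix agrees with one of the
blocks.  There are three cases.

* Some `2 × 2` submatrix without zeros is singular (`HasSingular`).  Its two rows agree up to scaling
  in two columns, so orthogonality makes them opposite in two further columns, and likewise for its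
  columns.  Continuing in both directions produces a growing chain of `2 × 2` cells (`Chain`), which
  has to close up since the matrix is finite, and then it is `E_{2m}(x)`
  (`IsWeighing.contains_E`).  This case occurs as soon as two rows have the same support
  (`IsWeighing.hasSingular_of_supp`).
* Otherwise, suppose that two rows share exactly three columns `x, y, z`.  The two rows can be taken
  to be `1 1 1 1 0` and `1 a a' 0 1`.  Parseval's identity for the Fourier matrix of order three
  then limits how another row can meet `x, y, z` (`ShareThreeNormal.meets`).  If a third row contains
  all three of them, then three more rows are forced and the result is `W₆`; if not, it is `W₅`
  (`IsWeighing.contains_W5_or_W6`).  Two columns sharing three rows are handled by transposition, as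
  `W₅` and `W₆` are symmetric.
* Otherwise any two lines share zero or two positions.  Any two columns of a given row lie in exactly
  one more common row, which gives six further rows; following their intersections leaves two
  patterns, those of `W₇` and `W₈` (`IsWeighing.containsPattern`), and orthogonality determines the
  entries up to scaling.

In a block every line has four nonzero entries, so a copy of a block in `W` splits off as a direct
summand (`IsWeighing.exists_similar_fromBlocks`), and induction on the order gives the
decomposition.  The order of the summands is irrelevant up to equivalence
(`similar_diagSum_of_perm`), so the kinds may be listed in an order depending only on the
decomposition of `n`; this gives the statements on numbers.
-/

noncomputable section

namespace UnitWeighing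

section

/-! ### Weighing matrices of weight four over arbitrary index types -/

variable {ι κ : Type}

theorem mul_star_of_norm {z : ℂ} (h : ‖z‖ = 1) : z * star z = 1 := by
  rw [Complex.star_def, Complex.mul_conj, Complex.normSq_eq_norm_sq, h]; simp

theorem star_mul_of_norm {z : ℂ} (h : ‖z‖ = 1) : star z * z = 1 := by
  rw [mul_comm, mul_star_of_norm h]

theorem ne_zero_of_norm {z : ℂ} (h : ‖z‖ = 1) : z ≠ 0 := by
  rintro rfl; simp at h

section Fintype

variable [Fintype ι] [Fintype κ]

/-- A unit weighing matrix of weight four with arbitrary finite index types for the rows and the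
columns.  The conditions are symmetric under transposition: four nonzero entries in each line, and
orthogonality of the rows as well as of the columns. -/
structure IsWeighing (W : Matrix ι κ ℂ) : Prop where
  entry : ∀ i j, W i j = 0 ∨ ‖W i j‖ = 1
  row_card : ∀ i, {j | W i j ≠ 0}.ncard = 4
  col_card : ∀ j, {i | W i j ≠ 0}.ncard = 4
  row_orth : ∀ i i', i ≠ i' → ∑ j, W i j * star (W i' j) = 0
  col_orth : ∀ j j', j ≠ j' → ∑ i, W i j * star (W i j') = 0

theorem IsWeighing.transpose {W : Matrix ι κ ℂ} (h : IsWeighing W) : IsWeighing Wᵀ :=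
  ⟨fun i j => h.entry j i, h.col_card, h.row_card, h.col_orth, h.row_orth⟩

theorem IsWeighing.norm {W : Matrix ι κ ℂ} (h : IsWeighing W) {i : ι} {j : κ} (hij : W i j ≠ 0) :
    ‖W i j‖ = 1 := (h.entry i j).resolve_left hij

end Fintype

/-- The support of `f` consists of the four distinct points `x, y, z, t`. -/
def Supp (f : κ → ℂ) (x y z t : κ) : Prop :=
  (x ≠ y ∧ x ≠ z ∧ x ≠ t ∧ y ≠ z ∧ y ≠ t ∧ z ≠ t) ∧
    ∀ j, f j ≠ 0 ↔ j = x ∨ j = y ∨ j = z ∨ j = t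

theorem exists_supp [Fintype κ] {f : κ → ℂ} (h : {j | f j ≠ 0}.ncard = 4) : ∃ x y z t, Supp f x y z t := by
  obtain ⟨s, hs⟩ := (Set.toFinite {j | f j ≠ 0}).exists_finset_coe
  rw [← hs, Set.ncard_coe_finset] at h
  classical
  obtain ⟨x, y, z, t, h1, h2, h3, h4, h5, h6, rfl⟩ := Finset.card_eq_four.1 h
  refine ⟨x, y, z, t, ⟨h1, h2, h3, h4, h5, h6⟩, fun j => ?_⟩
  have : j ∈ {j | f j ≠ 0} ↔ j ∈ (({x, y, z, t} : Finset κ) : Set κ) := by rw [hs]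
  simpa using this

theorem Supp.eq_zero {f : κ → ℂ} {x y z t j : κ} (h : Supp f x y z t) (hx : j ≠ x) (hy : j ≠ y)
    (hz : j ≠ z) (ht : j ≠ t) : f j = 0 := by
  by_contra h0
  rcases (h.2 j).1 h0 with e | e | e | e <;> contradiction

theorem Supp.ne_zero {f : κ → ℂ} {x y z t : κ} (h : Supp f x y z t) :
    f x ≠ 0 ∧ f y ≠ 0 ∧ f z ≠ 0 ∧ f t ≠ 0 := by
  simp [h.2]

theorem Supp.sum_eq [Fintype κ] {f g : κ → ℂ} {x y z t : κ} (h : Supp f x y z t) :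
    ∑ j, f j * g j = f x * g x + f y * g y + f z * g z + f t * g t := by
  classical
  obtain ⟨⟨h1, h2, h3, h4, h5, h6⟩, hs⟩ := h
  rw [← Finset.sum_subset (Finset.subset_univ ({x, y, z, t} : Finset κ))]
  · simp [*, add_assoc]
  · intro j _ hj
    have : f j = 0 := by
      by_contra h0
      have := (hs j).1 h0
      simp at hj
      tauto
    simp [this]

namespace IsWeighing

variable [Fintype ι] [Fintype κ] {W : Matrix ι κ ℂ}

theorem supp_four (h : IsWeighing W) (i : ι) {x y z t : κ}
    (hd : x ≠ y ∧ x ≠ z ∧ x ≠ t ∧ y ≠ z ∧ y ≠ t ∧ z ≠ t)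
    (hx : W i x ≠ 0) (hy : W i y ≠ 0) (hz : W i z ≠ 0) (ht : W i t ≠ 0) :
    Supp (W i) x y z t := by
  obtain ⟨p, q, r, s, -, hs⟩ := exists_supp (h.row_card i)
  refine ⟨hd, ?_⟩
  grind

theorem supp_three (h : IsWeighing W) (i : ι) {x y z : κ} (hxy : x ≠ y) (hxz : x ≠ z)
    (hyz : y ≠ z) (hx : W i x ≠ 0) (hy : W i y ≠ 0) (hz : W i z ≠ 0) :
    ∃ t, Supp (W i) x y z t := by
  obtain ⟨p, q, r, s, hs⟩ := exists_supp (h.row_card i)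
  have hn := hs.ne_zero
  obtain ⟨hd, hs⟩ := hs
  have : ∃ t, W i t ≠ 0 ∧ t ≠ x ∧ t ≠ y ∧ t ≠ z := by grind
  obtain ⟨t, ht, h1, h2, h3⟩ := this
  exact ⟨t, h.supp_four i ⟨hxy, hxz, h1.symm, hyz, h2.symm, h3.symm⟩ hx hy hz ht⟩

theorem supp_two (h : IsWeighing W) (i : ι) {x y : κ} (hxy : x ≠ y)
    (hx : W i x ≠ 0) (hy : W i y ≠ 0) : ∃ z t, Supp (W i) x y z t := by
  obtain ⟨p, q, r, s, hs⟩ := exists_supp (h.row_card i)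
  have hn := hs.ne_zero
  obtain ⟨hd, hs⟩ := hs
  have : ∃ z, W i z ≠ 0 ∧ z ≠ x ∧ z ≠ y := by grind
  obtain ⟨z, hz, h1, h2⟩ := this
  exact ⟨z, h.supp_three i hxy h1.symm h2.symm hx hy hz⟩

theorem supp_one (h : IsWeighing W) (i : ι) {x : κ} (hx : W i x ≠ 0) :
    ∃ y z t, Supp (W i) x y z t := by
  obtain ⟨p, q, r, s, hs⟩ := exists_supp (h.row_card i)
  have hn := hs.ne_zero
  obtain ⟨hd, hs⟩ := hs
  have : ∃ z, W i z ≠ 0 ∧ z ≠ x := by grind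
  obtain ⟨z, hz, h1⟩ := this
  exact ⟨z, h.supp_two i h1.symm hx hz⟩

/-- Orthogonality of two rows, written out on the support of the first one. -/
theorem orth (h : IsWeighing W) {i i' : ι} (hi : i ≠ i') {x y z t : κ} (hs : Supp (W i) x y z t) :
    W i x * star (W i' x) + W i y * star (W i' y) + W i z * star (W i' z)
      + W i t * star (W i' t) = 0 := by
  rw [← hs.sum_eq (g := fun j => star (W i' j))]
  exact h.row_orth i i' hi

/-- Orthogonality of two rows, written out on the support of the second one. -/
theorem orth' (h : IsWeighing W) {i i' : ι} (hi : i ≠ i') {x y z t : κ}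
    (hs : Supp (W i') x y z t) : W i x * star (W i' x) + W i y * star (W i' y)
      + W i z * star (W i' z) + W i t * star (W i' t) = 0 := by
  have hs' : Supp (fun j => star (W i' j)) x y z t := ⟨hs.1, fun j => by simpa using hs.2 j⟩
  have h1 := h.row_orth i i' hi
  simp only [mul_comm (W i _)] at h1 ⊢
  rw [← hs'.sum_eq (g := W i), h1]

end IsWeighing

/-! ### Scaling the rows and the columns -/

/-- `W'` arises from `W` by multiplying the rows and the columns by unimodular numbers. -/
def Scaled (W W' : Matrix ι κ ℂ) : Prop :=
  ∃ (ρ : ι → ℂ) (γ : κ → ℂ), (∀ i, ‖ρ i‖ = 1) ∧ (∀ j, ‖γ j‖ = 1) ∧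
    ∀ i j, W' i j = ρ i * γ j * W i j

theorem Scaled.trans {W W' W'' : Matrix ι κ ℂ} (h : Scaled W W') (h' : Scaled W' W'') :
    Scaled W W'' := by
  obtain ⟨ρ, γ, hρ, hγ, h⟩ := h
  obtain ⟨ρ', γ', hρ', hγ', h'⟩ := h'
  refine ⟨fun i => ρ' i * ρ i, fun j => γ' j * γ j, by simp [*], by simp [*], fun i j => ?_⟩
  rw [h', h]; ring

theorem Scaled.transpose {W W' : Matrix ι κ ℂ} (h : Scaled W W') : Scaled Wᵀ W'ᵀ := by
  obtain ⟨ρ, γ, hρ, hγ, h⟩ := h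
  refine ⟨γ, ρ, hγ, hρ, fun i j => ?_⟩
  rw [transpose_apply, h, transpose_apply]; ring

theorem Scaled.eq_zero_iff {W W' : Matrix ι κ ℂ} (h : Scaled W W') (i : ι) (j : κ) :
    W' i j = 0 ↔ W i j = 0 := by
  obtain ⟨ρ, γ, hρ, hγ, h⟩ := h
  simp [h, ne_zero_of_norm (hρ i), ne_zero_of_norm (hγ j)]

theorem Scaled.isWeighing [Fintype ι] [Fintype κ] {W W' : Matrix ι κ ℂ} (hs : Scaled W W') (h : IsWeighing W) :
    IsWeighing W' := by
  have h0 := hs.eq_zero_iff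
  obtain ⟨ρ, γ, hρ, hγ, hs⟩ := hs
  refine ⟨fun i j => ?_, fun i => ?_, fun j => ?_, fun i i' hi => ?_, fun j j' hj => ?_⟩
  · rw [h0, hs]; simpa [hρ, hγ] using h.entry i j
  · simpa [h0] using h.row_card i
  · simpa [h0] using h.col_card j
  · calc ∑ j, W' i j * star (W' i' j)
        = ∑ j, ρ i * star (ρ i') * (W i j * star (W i' j)) :=
          Finset.sum_congr rfl fun j _ => by
            rw [hs, hs, star_mul', star_mul']
            linear_combination ρ i * star (ρ i') * (W i j * star (W i' j)) *
              mul_star_of_norm (hγ j)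
      _ = 0 := by rw [← Finset.mul_sum, h.row_orth i i' hi, mul_zero]
  · calc ∑ i, W' i j * star (W' i j')
        = ∑ i, γ j * star (γ j') * (W i j * star (W i j')) :=
          Finset.sum_congr rfl fun i _ => by
            rw [hs, hs, star_mul', star_mul']
            linear_combination γ j * star (γ j') * (W i j * star (W i j')) *
              mul_star_of_norm (hρ i)
      _ = 0 := by rw [← Finset.mul_sum, h.col_orth j j' hj, mul_zero]

/-- The rows can be scaled so that in each row `i` the entry in column `f i` becomes `0` or `1`.
Rows in which this holds from the start do not change. -/
theorem IsWeighing.exists_scaled_rows [Fintype ι] [Fintype κ] {W : Matrix ι κ ℂ} (h : IsWeighing W) (f : ι → κ) :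
    ∃ W', Scaled W W' ∧ IsWeighing W' ∧ (∀ i j, W' i j ≠ 0 ↔ W i j ≠ 0) ∧
      (∀ i, W i (f i) ≠ 0 → W' i (f i) = 1) ∧
      ∀ i, W i (f i) = 0 ∨ W i (f i) = 1 → ∀ j, W' i j = W i j := by
  classical
  let ρ : ι → ℂ := fun i => if W i (f i) = 0 then 1 else star (W i (f i))
  have hs : Scaled W (fun i j => ρ i * W i j) := by
    refine ⟨ρ, 1, fun i => ?_, by simp, by simp⟩
    by_cases h0 : W i (f i) = 0
    · simp [ρ, h0]
    · simp [ρ, h0, h.norm h0]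
  refine ⟨_, hs, hs.isWeighing h, fun i j => not_congr (hs.eq_zero_iff i j), fun i hi => ?_,
    fun i hi j => ?_⟩
  · simpa [ρ, hi] using star_mul_of_norm (h.norm hi)
  · rcases hi with hi | hi <;> simp [ρ, hi]

/-- The analogue of `IsWeighing.exists_scaled_rows` for the columns. -/
theorem IsWeighing.exists_scaled_cols [Fintype ι] [Fintype κ] {W : Matrix ι κ ℂ} (h : IsWeighing W) (g : κ → ι) :
    ∃ W', Scaled W W' ∧ IsWeighing W' ∧ (∀ i j, W' i j ≠ 0 ↔ W i j ≠ 0) ∧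
      (∀ j, W (g j) j ≠ 0 → W' (g j) j = 1) ∧
      ∀ j, W (g j) j = 0 ∨ W (g j) j = 1 → ∀ i, W' i j = W i j := by
  obtain ⟨W', hs, hW, h1, h2, h3⟩ := h.transpose.exists_scaled_rows g
  exact ⟨W'ᵀ, hs.transpose, hW.transpose, fun i j => h1 j i, h2, fun j hj i => h3 j hj i⟩

/-- Normalization along a spanning tree.  The first row is scaled to ones; every other row is
scaled to have a one at its first nonzero entry among the columns `c0, c1, c2, c3`, and every other
column to have a one at its first nonzero entry among the rows `r1, r2, r3`. -/
theorem IsWeighing.exists_normalized [Fintype ι] [Fintype κ] {W : Matrix ι κ ℂ} (h : IsWeighing W)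
    (r0 r1 r2 r3 : ι) (c0 c1 c2 c3 : κ) (h0 : W r0 c0 ≠ 0) (h1 : W r0 c1 ≠ 0) (h2 : W r0 c2 ≠ 0)
    (k1 : W r1 c0 ≠ 0 ∨ W r1 c1 ≠ 0 ∨ W r1 c2 ≠ 0)
    (k2 : W r2 c0 ≠ 0 ∨ W r2 c1 ≠ 0 ∨ W r2 c2 ≠ 0)
    (k3 : W r3 c0 ≠ 0 ∨ W r3 c1 ≠ 0 ∨ W r3 c2 ≠ 0) :
    ∃ W', Scaled W W' ∧ IsWeighing W' ∧ (∀ i j, W' i j ≠ 0 ↔ W i j ≠ 0) ∧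
      (∀ j, W r0 j ≠ 0 → W' r0 j = 1) ∧
      (∀ j, W r0 j = 0 → W r1 j ≠ 0 → W' r1 j = 1) ∧
      (∀ j, W r0 j = 0 → W r1 j = 0 → W r2 j ≠ 0 → W' r2 j = 1) ∧
      (∀ j, W r0 j = 0 → W r1 j = 0 → W r2 j = 0 → W r3 j ≠ 0 → W' r3 j = 1) ∧
      (∀ i, W i c0 ≠ 0 → W' i c0 = 1) ∧
      (∀ i, W i c0 = 0 → W i c1 ≠ 0 → W' i c1 = 1) ∧
      (∀ i, W i c0 = 0 → W i c1 = 0 → W i c2 ≠ 0 → W' i c2 = 1) ∧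
      (∀ i, W i c0 = 0 → W i c1 = 0 → W i c2 = 0 → W i c3 ≠ 0 → W' i c3 = 1) := by
  classical
  obtain ⟨W1, s1, w1, z1, e1, -⟩ := h.exists_scaled_cols fun _ => r0
  let f (c : κ) (i : ι) : κ :=
    if W i c0 ≠ 0 then c0 else if W i c1 ≠ 0 then c1 else if W i c2 ≠ 0 then c2 else c
  have f0 : ∀ c i, W i c0 ≠ 0 → f c i = c0 := fun c i h => by simp [f, h]
  have f1 : ∀ c i, W i c0 = 0 → W i c1 ≠ 0 → f c i = c1 := fun c i h h' => by simp [f, h, h']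
  have f2 : ∀ c i, W i c0 = 0 → W i c1 = 0 → W i c2 ≠ 0 → f c i = c2 :=
    fun c i h h' h'' => by simp [f, h, h', h'']
  have f3 : ∀ c i, W i c0 = 0 → W i c1 = 0 → W i c2 = 0 → f c i = c :=
    fun c i h h' h'' => by simp [f, h, h', h'']
  obtain ⟨W2, s2, w2, z2, e2, t2⟩ := w1.exists_scaled_rows (f c2)
  let g (j : κ) : ι :=
    if W r0 j ≠ 0 then r0 else if W r1 j ≠ 0 then r1 else if W r2 j ≠ 0 then r2 else r3
  have g0 : ∀ j, W r0 j ≠ 0 → g j = r0 := fun j h => by simp [g, h]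
  have g1 : ∀ j, W r0 j = 0 → W r1 j ≠ 0 → g j = r1 := fun j h h' => by simp [g, h, h']
  have g2 : ∀ j, W r0 j = 0 → W r1 j = 0 → W r2 j ≠ 0 → g j = r2 :=
    fun j h h' h'' => by simp [g, h, h', h'']
  have g3 : ∀ j, W r0 j = 0 → W r1 j = 0 → W r2 j = 0 → g j = r3 :=
    fun j h h' h'' => by simp [g, h, h', h'']
  obtain ⟨W3, s3, w3, z3, e3, t3⟩ := w2.exists_scaled_cols g
  obtain ⟨W4, s4, w4, z4, e4, t4⟩ := w3.exists_scaled_rows (f c3)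
  have a2 : ∀ j, W r0 j ≠ 0 → W2 r0 j = 1 := fun j hj => by
    rw [t2 r0 (Or.inr (by rw [f0 _ _ h0]; exact e1 _ h0)), e1 j hj]
  have a3 : ∀ j, W r0 j ≠ 0 → ∀ i, W3 i j = W2 i j := fun j hj =>
    t3 j (Or.inr (by rw [g0 j hj, a2 j hj]))
  -- the entry in position `(i, f i)` becomes one in the second step and remains so afterwards
  have b0 : ∀ i, W i c0 ≠ 0 → W3 i c0 = 1 := fun i hi => by
    have := e2 i
    rw [f0 _ i hi] at this
    rw [a3 _ h0, this ((z1 _ _).2 hi)]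
  have b1 : ∀ i, W i c0 = 0 → W i c1 ≠ 0 → W3 i c1 = 1 := fun i hi hi' => by
    have := e2 i
    rw [f1 _ i hi hi'] at this
    rw [a3 _ h1, this ((z1 _ _).2 hi')]
  have b2 : ∀ i, W i c0 = 0 → W i c1 = 0 → W i c2 ≠ 0 → W3 i c2 = 1 := fun i hi hi' hi'' => by
    have := e2 i
    rw [f2 _ i hi hi' hi''] at this
    rw [a3 _ h2, this ((z1 _ _).2 hi'')]
  have b4 : ∀ i, W i c0 ≠ 0 ∨ W i c1 ≠ 0 ∨ W i c2 ≠ 0 → ∀ j, W4 i j = W3 i j := by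
    intro i hi
    apply t4 i
    right
    by_cases i0 : W i c0 = 0
    · by_cases i1 : W i c1 = 0
      · have i2 : W i c2 ≠ 0 := by tauto
        rw [f2 _ i i0 i1 i2, b2 i i0 i1 i2]
      · rw [f1 _ i i0 i1, b1 i i0 i1]
    · rw [f0 _ i i0, b0 i i0]
  have zz : ∀ i j, W3 i j ≠ 0 ↔ W i j ≠ 0 := fun i j => by rw [z3, z2, z1]
  have z21 : ∀ i j, W2 i j ≠ 0 ↔ W i j ≠ 0 := fun i j => by rw [z2, z1]
  refine ⟨W4, ((s1.trans s2).trans s3).trans s4, w4, fun i j => by rw [z4, zz], ?_, ?_, ?_, ?_,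
    ?_, ?_, ?_, ?_⟩
  · intro j hj
    rw [b4 r0 (Or.inl h0), a3 j hj, a2 j hj]
  · intro j hj hj'
    have := e3 j
    rw [g1 j hj hj'] at this
    rw [b4 r1 k1, this ((z21 _ _).2 hj')]
  · intro j hj hj' hj''
    have := e3 j
    rw [g2 j hj hj' hj''] at this
    rw [b4 r2 k2, this ((z21 _ _).2 hj'')]
  · intro j hj hj' hj'' hj'''
    have := e3 j
    rw [g3 j hj hj' hj''] at this
    rw [b4 r3 k3, this ((z21 _ _).2 hj''')]
  · intro i hi
    rw [b4 i (Or.inl hi), b0 i hi]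
  · intro i hi hi'
    rw [b4 i (Or.inr (Or.inl hi')), b1 i hi hi']
  · intro i hi hi' hi''
    rw [b4 i (Or.inr (Or.inr hi'')), b2 i hi hi' hi'']
  · intro i hi hi' hi'' hi'''
    have := e4 i
    rw [f3 _ i hi hi' hi''] at this
    exact this ((zz _ _).2 hi''')

/-! ### Submatrices equivalent to a block -/

/-- `W` has a submatrix which on the support of `B` agrees with `B` up to scaling. -/
def Contains {k : ℕ} (W : Matrix ι κ ℂ) (B : Matrix (Fin k) (Fin k) ℂ) : Prop :=
  ∃ (r : Fin k → ι) (c : Fin k → κ) (ρ γ : Fin k → ℂ), r.Injective ∧ c.Injective ∧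
    (∀ i, ‖ρ i‖ = 1) ∧ (∀ j, ‖γ j‖ = 1) ∧ ∀ i j, B i j ≠ 0 → W (r i) (c j) = ρ i * γ j * B i j

theorem Contains.of_scaled {k : ℕ} {W W' : Matrix ι κ ℂ} {B : Matrix (Fin k) (Fin k) ℂ}
    (hs : Scaled W W') (h : Contains W' B) : Contains W B := by
  obtain ⟨ρ, γ, hρ, hγ, hs⟩ := hs
  obtain ⟨r, c, ρ', γ', hr, hc, hρ', hγ', h⟩ := h
  refine ⟨r, c, fun i => star (ρ (r i)) * ρ' i, fun j => star (γ (c j)) * γ' j, hr, hc,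
    by simp [*], by simp [*], fun i j hij => ?_⟩
  have h1 := h i j hij
  rw [hs] at h1
  linear_combination star (ρ (r i)) * star (γ (c j)) * h1
    - star (γ (c j)) * γ (c j) * W (r i) (c j) * star_mul_of_norm (hρ (r i))
    - W (r i) (c j) * star_mul_of_norm (hγ (c j))

theorem Contains.of_transpose {k : ℕ} {W : Matrix ι κ ℂ} {B : Matrix (Fin k) (Fin k) ℂ}
    (hB : Bᵀ = B) (h : Contains Wᵀ B) : Contains W B := by
  obtain ⟨r, c, ρ, γ, hr, hc, hρ, hγ, h⟩ := h
  refine ⟨c, r, γ, ρ, hc, hr, hγ, hρ, fun i j hij => ?_⟩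
  have hb : B j i = B i j := congrFun (congrFun hB i) j
  have := h j i (hb ▸ hij)
  rw [transpose_apply] at this
  rw [this, hb]; ring

theorem Contains.of_eq {k : ℕ} {W : Matrix ι κ ℂ} {B : Matrix (Fin k) (Fin k) ℂ}
    (r : Fin k → ι) (c : Fin k → κ) (hr : r.Injective) (hc : c.Injective)
    (h : ∀ i j, B i j ≠ 0 → W (r i) (c j) = B i j) : Contains W B :=
  ⟨r, c, 1, 1, hr, hc, by simp, by simp, by simpa using h⟩

end

section

variable {ι κ : Type}

/-! ### Any two lines share no or two positions: the blocks of orders seven and eight -/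

/-- Two distinct rows which share a position share another one. -/
theorem IsWeighing.exists_common [Fintype ι] [Fintype κ] {W : Matrix ι κ ℂ} (h : IsWeighing W)
    {i i' : ι} {j : κ} (hi : i ≠ i') (hj : W i j ≠ 0) (hj' : W i' j ≠ 0) :
    ∃ j', j' ≠ j ∧ W i j' ≠ 0 ∧ W i' j' ≠ 0 := by
  obtain ⟨x, y, z, hs⟩ := h.supp_one i hj
  have h1 := h.orth hi hs
  have hn := hs.ne_zero
  by_contra! hc
  have h2 := hc x (by have := hs.1; tauto) (by tauto)
  have h3 := hc y (by have := hs.1; tauto) (by tauto)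
  have h4 := hc z (by have := hs.1; tauto) (by tauto)
  simp [h2, h3, h4, hj, hj'] at h1

/-- Two rows share at most two positions. -/
def AtMostTwo (W : Matrix ι κ ℂ) : Prop :=
  ∀ i i' x y z, W i x ≠ 0 → W i y ≠ 0 → W i z ≠ 0 → W i' x ≠ 0 → W i' y ≠ 0 → W i' z ≠ 0 →
    x ≠ y → x ≠ z → y ≠ z → i = i'

/-- `W` has a submatrix whose support contains that of `B`. -/
def ContainsPattern {k : ℕ} (W : Matrix ι κ ℂ) (B : Matrix (Fin k) (Fin k) ℂ) : Prop :=
  ∃ (r : Fin k → ι) (c : Fin k → κ), r.Injective ∧ c.Injective ∧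
    ∀ i j, B i j ≠ 0 → W (r i) (c j) ≠ 0

theorem injective_seven {α : Type} {x0 x1 x2 x3 x4 x5 x6 : α}
    (h : [x0, x1, x2, x3, x4, x5, x6].Nodup) :
    Function.Injective ![x0, x1, x2, x3, x4, x5, x6] := by
  have := List.nodup_iff_injective_get.1 h
  intro i j hij
  apply this
  fin_cases i <;> fin_cases j <;> exact hij

theorem injective_eight {α : Type} {x0 x1 x2 x3 x4 x5 x6 x7 : α}
    (h : [x0, x1, x2, x3, x4, x5, x6, x7].Nodup) :
    Function.Injective ![x0, x1, x2, x3, x4, x5, x6, x7] := by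
  have := List.nodup_iff_injective_get.1 h
  intro i j hij
  apply this
  fin_cases i <;> fin_cases j <;> exact hij

set_option maxHeartbeats 400000 in
/-- If any two lines share at most two positions, then they share none or two, and the support of
`W` contains a copy of the support of `W₇` or of `W₈`. -/
theorem IsWeighing.containsPattern [Fintype ι] [Fintype κ] [Nonempty ι] {W : Matrix ι κ ℂ}
    (h : IsWeighing W) (hr : AtMostTwo W) (hc : AtMostTwo Wᵀ) :
    ContainsPattern W W7 ∨ ContainsPattern W W8 := by
  have hr2 : ∀ {i i' j}, i ≠ i' → W i j ≠ 0 → W i' j ≠ 0 →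
    ∃ j', j' ≠ j ∧ W i j' ≠ 0 ∧ W i' j' ≠ 0 := h.exists_common
  have hc2 : ∀ {j j' i}, j ≠ j' → W i j ≠ 0 → W i j' ≠ 0 →
    ∃ i', i' ≠ i ∧ W i' j ≠ 0 ∧ W i' j' ≠ 0 := h.transpose.exists_common
  replace hc : ∀ j j' x y z, W x j ≠ 0 → W y j ≠ 0 → W z j ≠ 0 → W x j' ≠ 0 → W y j' ≠ 0 →
    W z j' ≠ 0 → x ≠ y → x ≠ z → y ≠ z → j = j' := hc
  obtain ⟨r0⟩ := ‹Nonempty ι›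
  obtain ⟨c1, c2, c3, c4, h0⟩ := exists_supp (h.row_card r0)
  obtain ⟨a1, a2, a3, a4⟩ := h0.ne_zero
  obtain ⟨⟨n12, n13, n14, n23, n24, n34⟩, h0⟩ := h0
  -- the row `rij` is the second row which contains the columns `ci` and `cj`
  obtain ⟨r12, m12, i12, j12⟩ := hc2 n12 a1 a2
  obtain ⟨r13, m13, i13, j13⟩ := hc2 n13 a1 a3
  obtain ⟨r14, m14, i14, j14⟩ := hc2 n14 a1 a4
  obtain ⟨r23, m23, i23, j23⟩ := hc2 n23 a2 a3
  obtain ⟨r24, m24, i24, j24⟩ := hc2 n24 a2 a4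
  obtain ⟨r34, m34, i34, j34⟩ := hc2 n34 a3 a4
  have hr3 : ∀ {i i'} (x y z), i ≠ i' → x ≠ y → W i x ≠ 0 → W i y ≠ 0 → W i' x ≠ 0 →
      W i' y ≠ 0 → z ≠ x → z ≠ y → W i z ≠ 0 → W i' z = 0 := by
    intro i i' x y z hi hxy h1 h2 h3 h4 hx hy h5
    by_contra h6
    exact hi (hr i i' x y z h1 h2 h5 h3 h4 h6 hxy hx.symm hy.symm)
  have z12_3 := hr3 c1 c2 c3 m12.symm n12 a1 a2 i12 j12 n13.symm n23.symm a3
  have z12_4 := hr3 c1 c2 c4 m12.symm n12 a1 a2 i12 j12 n14.symm n24.symm a4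
  have z13_2 := hr3 c1 c3 c2 m13.symm n13 a1 a3 i13 j13 n12.symm n23 a2
  have z13_4 := hr3 c1 c3 c4 m13.symm n13 a1 a3 i13 j13 n14.symm n34.symm a4
  have z14_2 := hr3 c1 c4 c2 m14.symm n14 a1 a4 i14 j14 n12.symm n24 a2
  have z14_3 := hr3 c1 c4 c3 m14.symm n14 a1 a4 i14 j14 n13.symm n34 a3
  have z23_1 := hr3 c2 c3 c1 m23.symm n23 a2 a3 i23 j23 n12 n13 a1
  have z23_4 := hr3 c2 c3 c4 m23.symm n23 a2 a3 i23 j23 n24.symm n34.symm a4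
  have z24_1 := hr3 c2 c4 c1 m24.symm n24 a2 a4 i24 j24 n12 n14 a1
  have z24_3 := hr3 c2 c4 c3 m24.symm n24 a2 a4 i24 j24 n23.symm n34 a3
  have z34_1 := hr3 c3 c4 c1 m34.symm n34 a3 a4 i34 j34 n13 n14 a1
  have z34_2 := hr3 c3 c4 c2 m34.symm n34 a3 a4 i34 j34 n23 n24 a2
  have d1 : r12 ≠ r13 := by rintro rfl; contradiction
  have d2 : r12 ≠ r14 := by rintro rfl; contradiction
  have d3 : r13 ≠ r14 := by rintro rfl; contradiction
  obtain ⟨x, nx1, hx2, hx3⟩ := hr2 d1 i12 i13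
  obtain ⟨y, ny1, hy2, hy4⟩ := hr2 d2 i12 i14
  obtain ⟨z, nz1, hz3, hz4⟩ := hr2 d3 i13 i14
  have x2 : x ≠ c2 := by rintro rfl; contradiction
  have x3 : x ≠ c3 := by rintro rfl; contradiction
  have x4 : x ≠ c4 := by rintro rfl; contradiction
  have y2 : y ≠ c2 := by rintro rfl; contradiction
  have y3 : y ≠ c3 := by rintro rfl; contradiction
  have y4 : y ≠ c4 := by rintro rfl; contradiction
  have z2 : z ≠ c2 := by rintro rfl; contradiction
  have z3 : z ≠ c3 := by rintro rfl; contradiction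
  have z4 : z ≠ c4 := by rintro rfl; contradiction
  have xy : x ≠ y := by
    rintro rfl
    exact nx1 (hc x c1 r12 r13 r14 hx2 hx3 hy4 i12 i13 i14 d1 d2 d3)
  have xz : x ≠ z := by
    rintro rfl
    exact nx1 (hc x c1 r12 r13 r14 hx2 hx3 hz4 i12 i13 i14 d1 d2 d3)
  have yz : y ≠ z := by
    rintro rfl
    exact ny1 (hc y c1 r12 r13 r14 hy2 hz3 hy4 i12 i13 i14 d1 d2 d3)
  have s12 := h.supp_four r12 ⟨n12, nx1.symm, ny1.symm, x2.symm, y2.symm, xy⟩ i12 j12 hx2 hy2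
  have s13 := h.supp_four r13 ⟨n13, nx1.symm, nz1.symm, x3.symm, z3.symm, xz⟩ i13 j13 hx3 hz3
  have s14 := h.supp_four r14 ⟨n14, ny1.symm, nz1.symm, y4.symm, z4.symm, yz⟩ i14 j14 hy4 hz4
  have e1 : r12 ≠ r23 := by rintro rfl; contradiction
  have e2 : r12 ≠ r24 := by rintro rfl; contradiction
  have e3 : r13 ≠ r23 := by rintro rfl; contradiction
  have e4 : r13 ≠ r34 := by rintro rfl; contradiction
  have e5 : r14 ≠ r24 := by rintro rfl; contradiction
  have e6 : r14 ≠ r34 := by rintro rfl; contradiction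
  have e7 : r23 ≠ r24 := by rintro rfl; contradiction
  have e8 : r23 ≠ r34 := by rintro rfl; contradiction
  have e9 : r24 ≠ r34 := by rintro rfl; contradiction
  have e10 : r12 ≠ r34 := by rintro rfl; contradiction
  have e11 : r13 ≠ r24 := by rintro rfl; contradiction
  have e12 : r14 ≠ r23 := by rintro rfl; contradiction
  have a23 : W r23 x ≠ 0 ∨ W r23 y ≠ 0 := by
    obtain ⟨t, t1, t2, t3⟩ := hr2 e1 j12 i23
    rcases (s12.2 t).1 t2 with rfl | rfl | rfl | rfl <;>
        first | contradiction | assumption | exact Or.inl t3 | exact Or.inr t3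
  have a24 : W r24 x ≠ 0 ∨ W r24 y ≠ 0 := by
    obtain ⟨t, t1, t2, t3⟩ := hr2 e2 j12 i24
    rcases (s12.2 t).1 t2 with rfl | rfl | rfl | rfl <;>
        first | contradiction | assumption | exact Or.inl t3 | exact Or.inr t3
  have a34 : W r34 x ≠ 0 ∨ W r34 z ≠ 0 := by
    obtain ⟨t, t1, t2, t3⟩ := hr2 e4 j13 i34
    rcases (s13.2 t).1 t2 with rfl | rfl | rfl | rfl <;>
        first | contradiction | assumption | exact Or.inl t3 | exact Or.inr t3
  have zx4 : W r14 x = 0 := by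
    by_contra hh
    rcases (s14.2 x).1 hh with rfl | rfl | rfl | rfl <;> contradiction
  have zy3 : W r13 y = 0 := by
    by_contra hh
    rcases (s13.2 y).1 hh with rfl | rfl | rfl | rfl <;> contradiction
  have zz2 : W r12 z = 0 := by
    by_contra hh
    rcases (s12.2 z).1 hh with rfl | rfl | rfl | rfl <;> contradiction
  by_cases hx23 : W r23 x = 0
  · -- the second column shared by `r12` and `r23` is `y`; this leads to the order seven
    have hy23 : W r23 y ≠ 0 := a23.resolve_left (not_not.2 hx23)
    have hy24 : W r24 y = 0 := by
      by_contra hh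
      exact y2 (hc y c2 r12 r23 r24 hy2 hy23 hh j12 i23 i24 e1 e2 e7)
    have hx24 : W r24 x ≠ 0 := a24.resolve_right (not_not.2 hy24)
    have hz23 : W r23 z ≠ 0 := by
      obtain ⟨t, t1, t2, t3⟩ := hr2 e3 j13 j23
      rcases (s13.2 t).1 t2 with rfl | rfl | rfl | rfl <;>
        first | contradiction | assumption
    have hz24 : W r24 z ≠ 0 := by
      obtain ⟨t, t1, t2, t3⟩ := hr2 e5 j14 j24
      rcases (s14.2 t).1 t2 with rfl | rfl | rfl | rfl <;>
        first | contradiction | assumption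
    have hz34 : W r34 z = 0 := by
      by_contra hh
      exact z3 (hc z c3 r13 r23 r34 hz3 hz23 hh j13 j23 i34 e3 e4 e8)
    have hx34 : W r34 x ≠ 0 := a34.resolve_right (not_not.2 hz34)
    have hy34 : W r34 y ≠ 0 := by
      obtain ⟨t, t1, t2, t3⟩ := hr2 e6 j14 j34
      rcases (s14.2 t).1 t2 with rfl | rfl | rfl | rfl <;>
        first | contradiction | assumption
    refine Or.inl ⟨![r0, r12, r13, r14, r23, r24, r34], ![c1, c2, c3, c4, x, y, z],
      injective_seven ?_, injective_seven ?_, ?_⟩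
    · simp [m12.symm, m13.symm, m14.symm, m23.symm, m24.symm, m34.symm, d1, d2, d3, e1, e2, e3, e4,
        e5, e6, e7, e8, e9, e10, e11, e12]
    · simp [n12, n13, n14, n23, n24, n34, nx1.symm, ny1.symm, nz1.symm, x2.symm, x3.symm, x4.symm,
        y2.symm, y3.symm, y4.symm, z2.symm, z3.symm, z4.symm, xy, xz, yz]
    · simp [Fin.forall_fin_succ, W7]
      exact ⟨⟨a1, a2, a3, a4⟩, ⟨i12, j12, hx2, hy2⟩, ⟨i13, j13, hx3, hz3⟩, ⟨i14, j14, hy4, hz4⟩,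
        ⟨i23, j23, hy23, hz23⟩, ⟨i24, j24, hx24, hz24⟩, ⟨i34, j34, hx34, hy34⟩⟩
  · -- the second column shared by `r12` and `r23` is `x`; this leads to the order eight
    have hz23 : W r23 z = 0 :=
      hr3 c3 x z e3 x3.symm j13 hx3 j23 hx23 z3 xz.symm hz3
    have hy23 : W r23 y = 0 :=
      hr3 c2 x y e1 x2.symm j12 hx2 i23 hx23 y2 xy.symm hy2
    have hx24 : W r24 x = 0 := by
      by_contra hh
      exact x2 (hc x c2 r12 r23 r24 hx2 hx23 hh j12 i23 i24 e1 e2 e7)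
    have hy24 : W r24 y ≠ 0 := a24.resolve_left (not_not.2 hx24)
    have hz24 : W r24 z = 0 :=
      hr3 c4 y z e5 y4.symm j14 hy4 j24 hy24 z4 yz.symm hz4
    have hx34 : W r34 x = 0 := by
      by_contra hh
      exact x3 (hc x c3 r13 r23 r34 hx3 hx23 hh j13 j23 i34 e3 e4 e8)
    have hz34 : W r34 z ≠ 0 := a34.resolve_left (not_not.2 hx34)
    have hy34 : W r34 y = 0 :=
      hr3 c4 z y e6 z4.symm j14 hz4 j34 hz34 y4 yz hy4
    obtain ⟨w, w2, hw23, hw24⟩ := hr2 e7 i23 i24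
    have w1 : w ≠ c1 := by rintro rfl; contradiction
    have w3 : w ≠ c3 := by rintro rfl; contradiction
    have w4 : w ≠ c4 := by rintro rfl; contradiction
    have wx : w ≠ x := by rintro rfl; contradiction
    have wy : w ≠ y := by rintro rfl; contradiction
    have wz : w ≠ z := by rintro rfl; contradiction
    have s23 := h.supp_four r23 ⟨n23, x2.symm, w2.symm, x3.symm, w3.symm, wx.symm⟩ i23 j23 hx23 hw23
    have hw34 : W r34 w ≠ 0 := by
      obtain ⟨t, t1, t2, t3⟩ := hr2 e8 j23 i34
      rcases (s23.2 t).1 t2 with rfl | rfl | rfl | rfl <;>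
        first | contradiction | assumption
    have t2 := h.transpose.supp_four c2 ⟨m12.symm, m23.symm, m24.symm, e1, e2, e7⟩ a2 j12 i23 i24
    have t3 := h.transpose.supp_four c3 ⟨m13.symm, m23.symm, m34.symm, e3, e4, e8⟩ a3 j13 j23 i34
    have t1 := h.transpose.supp_four c1 ⟨m12.symm, m13.symm, m14.symm, d1, d2, d3⟩ a1 i12 i13 i14
    obtain ⟨r, f12, hx, hy⟩ := hc2 xy hx2 hy2
    have x0 : W r0 x = 0 := by
      by_contra hh
      rcases (h0 x).1 hh with rfl | rfl | rfl | rfl <;> contradiction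
    have f0 : r ≠ r0 := by rintro rfl; contradiction
    have f13 : r ≠ r13 := by rintro rfl; contradiction
    have f14 : r ≠ r14 := by rintro rfl; contradiction
    have f23 : r ≠ r23 := by rintro rfl; contradiction
    have f24 : r ≠ r24 := by rintro rfl; contradiction
    have f34 : r ≠ r34 := by rintro rfl; contradiction
    have hz : W r z ≠ 0 := by
      obtain ⟨t, t1', t2', t3'⟩ := hr2 f13 hx hx3
      rcases (s13.2 t).1 t3' with rfl | rfl | rfl | rfl
      · rcases (t1.2 r).1 t2' with rfl | rfl | rfl | rfl <;> contradiction
      · rcases (t3.2 r).1 t2' with rfl | rfl | rfl | rfl <;> contradiction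
      · contradiction
      · exact t2'
    have hw : W r w ≠ 0 := by
      obtain ⟨t, t1', t2', t3'⟩ := hr2 f23 hx hx23
      rcases (s23.2 t).1 t3' with rfl | rfl | rfl | rfl
      · rcases (t2.2 r).1 t2' with rfl | rfl | rfl | rfl <;> contradiction
      · rcases (t3.2 r).1 t2' with rfl | rfl | rfl | rfl <;> contradiction
      · contradiction
      · exact t2'
    refine Or.inr ⟨![r0, r12, r13, r14, r23, r24, r34, r], ![c1, c2, c3, c4, x, y, z, w],
      injective_eight ?_, injective_eight ?_, ?_⟩
    · simp [m12.symm, m13.symm, m14.symm, m23.symm, m24.symm, m34.symm, d1, d2, d3, e1, e2, e3, e4,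
        e5, e6, e7, e8, e9, e10, e11, e12,
        f0.symm, f12.symm, f13.symm, f14.symm, f23.symm, f24.symm, f34.symm]
    · simp [n12, n13, n14, n23, n24, n34, nx1.symm, ny1.symm, nz1.symm, x2.symm, x3.symm, x4.symm,
        y2.symm, y3.symm, y4.symm, z2.symm, z3.symm, z4.symm, xy, xz, yz,
        w1.symm, w2.symm, w3.symm, w4.symm, wx.symm, wy.symm, wz.symm]
    · simp [Fin.forall_fin_succ, W8]
      exact ⟨⟨a1, a2, a3, a4⟩, ⟨i12, j12, hx2, hy2⟩, ⟨i13, j13, hx3, hz3⟩, ⟨i14, j14, hy4, hz4⟩,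
        ⟨i23, j23, hx23, hw23⟩, ⟨i24, j24, hy24, hw24⟩, ⟨i34, j34, hz34, hw34⟩, ⟨hx, hy, hz, hw⟩⟩

theorem IsWeighing.supp_of_injective {k : ℕ} [Fintype ι] [Fintype κ] {W : Matrix ι κ ℂ}
    (h : IsWeighing W) {c : Fin k → κ} (hc : c.Injective) (i : ι) (x y z t : Fin k)
    (hd : x ≠ y ∧ x ≠ z ∧ x ≠ t ∧ y ≠ z ∧ y ≠ t ∧ z ≠ t) (hx : W i (c x) ≠ 0) (hy : W i (c y) ≠ 0)
    (hz : W i (c z) ≠ 0) (ht : W i (c t) ≠ 0) :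
    Supp (W i) (c x) (c y) (c z) (c t) ∧
      ∀ j, j ≠ x → j ≠ y → j ≠ z → j ≠ t → W i (c j) = 0 := by
  have hs := h.supp_four i (by simpa [hc.eq_iff] using hd) hx hy hz ht
  refine ⟨hs, fun j h1 h2 h3 h4 => ?_⟩
  by_contra h0
  have := (hs.2 (c j)).1 h0
  simp [hc.eq_iff] at this
  tauto

theorem Supp.congr {f g : κ → ℂ} {x y z t : κ} (h : Supp f x y z t)
    (hfg : ∀ j, g j ≠ 0 ↔ f j ≠ 0) : Supp g x y z t :=
  ⟨h.1, fun j => by rw [hfg, h.2]⟩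

/-- After normalization along a spanning tree, orthogonality determines the remaining entries one
after the other: in each step two rows share two columns, and three of the four entries are
known. -/
theorem IsWeighing.contains_W7 [Fintype ι] [Fintype κ] {W : Matrix ι κ ℂ} (h : IsWeighing W)
    (hP : ContainsPattern W W7) : Contains W W7 := by
  obtain ⟨r, c, hr, hc, hB⟩ := hP
  simp [Fin.forall_fin_succ, W7] at hB
  obtain ⟨⟨a00, a01, a02, a03⟩, ⟨a10, a11, a14, a15⟩, ⟨a20, a22, a24, a26⟩,
    ⟨a30, a33, a35, a36⟩, ⟨a41, a42, a45, a46⟩, ⟨a51, a53, a54, a56⟩, ⟨a62, a63, a64, a65⟩⟩ := hB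
  obtain ⟨s0, z0⟩ := h.supp_of_injective hc (r 0) 0 1 2 3 (by decide) a00 a01 a02 a03
  obtain ⟨s1, z1⟩ := h.supp_of_injective hc (r 1) 0 1 4 5 (by decide) a10 a11 a14 a15
  obtain ⟨s2, z2⟩ := h.supp_of_injective hc (r 2) 0 2 4 6 (by decide) a20 a22 a24 a26
  obtain ⟨s3, z3⟩ := h.supp_of_injective hc (r 3) 0 3 5 6 (by decide) a30 a33 a35 a36
  obtain ⟨s4, z4⟩ := h.supp_of_injective hc (r 4) 1 2 5 6 (by decide) a41 a42 a45 a46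
  obtain ⟨s5, z5⟩ := h.supp_of_injective hc (r 5) 1 3 4 6 (by decide) a51 a53 a54 a56
  obtain ⟨s6, z6⟩ := h.supp_of_injective hc (r 6) 2 3 4 5 (by decide) a62 a63 a64 a65
  obtain ⟨W', hs, hW, hz, p0, p1, p2, p3, q0, q1, q2, q3⟩ := h.exists_normalized
    (r 0) (r 1) (r 2) (r 1) (c 0) (c 1) (c 2) (c 0) a00 a01 a02 (Or.inl a10) (Or.inl a20)
    (by tauto)
  replace s0 := s0.congr (hz (r 0))
  replace s1 := s1.congr (hz (r 1))
  replace s2 := s2.congr (hz (r 2))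
  replace s3 := s3.congr (hz (r 3))
  replace s4 := s4.congr (hz (r 4))
  replace s5 := s5.congr (hz (r 5))
  replace s6 := s6.congr (hz (r 6))
  have y0 := fun j h1 h2 h3 h4 => (hs.eq_zero_iff (r 0) (c j)).2 (z0 j h1 h2 h3 h4)
  have y1 := fun j h1 h2 h3 h4 => (hs.eq_zero_iff (r 1) (c j)).2 (z1 j h1 h2 h3 h4)
  have y2 := fun j h1 h2 h3 h4 => (hs.eq_zero_iff (r 2) (c j)).2 (z2 j h1 h2 h3 h4)
  have y3 := fun j h1 h2 h3 h4 => (hs.eq_zero_iff (r 3) (c j)).2 (z3 j h1 h2 h3 h4)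
  have y4 := fun j h1 h2 h3 h4 => (hs.eq_zero_iff (r 4) (c j)).2 (z4 j h1 h2 h3 h4)
  have y5 := fun j h1 h2 h3 h4 => (hs.eq_zero_iff (r 5) (c j)).2 (z5 j h1 h2 h3 h4)
  have y6 := fun j h1 h2 h3 h4 => (hs.eq_zero_iff (r 6) (c j)).2 (z6 j h1 h2 h3 h4)
  have v00 : W' (r 0) (c 0) = 1 := p0 _  a00
  have v01 : W' (r 0) (c 1) = 1 := p0 _  a01
  have v02 : W' (r 0) (c 2) = 1 := p0 _  a02
  have v03 : W' (r 0) (c 3) = 1 := p0 _  a03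
  have v14 : W' (r 1) (c 4) = 1 := p1 _ (z0 4 (by decide) (by decide) (by decide) (by decide)) a14
  have v15 : W' (r 1) (c 5) = 1 := p1 _ (z0 5 (by decide) (by decide) (by decide) (by decide)) a15
  have v26 : W' (r 2) (c 6) = 1 := p2 _ (z0 6 (by decide) (by decide) (by decide) (by decide)) (z1 6 (by decide) (by decide) (by decide) (by decide)) a26
  have v10 : W' (r 1) (c 0) = 1 := q0 _  a10
  have v20 : W' (r 2) (c 0) = 1 := q0 _  a20
  have v30 : W' (r 3) (c 0) = 1 := q0 _  a30
  have v41 : W' (r 4) (c 1) = 1 := q1 _ (z4 0 (by decide) (by decide) (by decide) (by decide)) a41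
  have v51 : W' (r 5) (c 1) = 1 := q1 _ (z5 0 (by decide) (by decide) (by decide) (by decide)) a51
  have v62 : W' (r 6) (c 2) = 1 := q2 _ (z6 0 (by decide) (by decide) (by decide) (by decide)) (z6 1 (by decide) (by decide) (by decide) (by decide)) a62
  have v11 : W' (r 1) (c 1) = -1 := by
    have := hW.orth' (hr.ne (by decide : (1 : Fin 7) ≠ 0)) s0
    simp [y1, v00, v01, v10] at this
    linear_combination this
  have v22 : W' (r 2) (c 2) = -1 := by
    have := hW.orth' (hr.ne (by decide : (2 : Fin 7) ≠ 0)) s0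
    simp [y2, v00, v02, v20] at this
    linear_combination this
  have v24 : W' (r 2) (c 4) = -1 := by
    have := hW.orth' (hr.ne (by decide : (2 : Fin 7) ≠ 1)) s1
    simp [y2, v10, v14, v20] at this
    linear_combination this
  have v33 : W' (r 3) (c 3) = -1 := by
    have := hW.orth' (hr.ne (by decide : (3 : Fin 7) ≠ 0)) s0
    simp [y3, v00, v03, v30] at this
    linear_combination this
  have v35 : W' (r 3) (c 5) = -1 := by
    have := hW.orth' (hr.ne (by decide : (3 : Fin 7) ≠ 1)) s1
    simp [y3, v10, v15, v30] at this
    linear_combination this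
  have v36 : W' (r 3) (c 6) = -1 := by
    have := hW.orth' (hr.ne (by decide : (3 : Fin 7) ≠ 2)) s2
    simp [y3, v20, v26, v30] at this
    linear_combination this
  have v42 : W' (r 4) (c 2) = -1 := by
    have := hW.orth' (hr.ne (by decide : (4 : Fin 7) ≠ 0)) s0
    simp [y4, v01, v02, v41] at this
    linear_combination this
  have v45 : W' (r 4) (c 5) = 1 := by
    have := hW.orth' (hr.ne (by decide : (4 : Fin 7) ≠ 1)) s1
    simp [y4, v11, v15, v41] at this
    linear_combination this
  have v46 : W' (r 4) (c 6) = -1 := by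
    have := hW.orth' (hr.ne (by decide : (4 : Fin 7) ≠ 2)) s2
    simp [y4, v22, v26, v42] at this
    linear_combination this
  have v53 : W' (r 5) (c 3) = -1 := by
    have := hW.orth' (hr.ne (by decide : (5 : Fin 7) ≠ 0)) s0
    simp [y5, v01, v03, v51] at this
    linear_combination this
  have v54 : W' (r 5) (c 4) = 1 := by
    have := hW.orth' (hr.ne (by decide : (5 : Fin 7) ≠ 1)) s1
    simp [y5, v11, v14, v51] at this
    linear_combination this
  have v56 : W' (r 5) (c 6) = 1 := by
    have := hW.orth' (hr.ne (by decide : (5 : Fin 7) ≠ 2)) s2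
    simp [y5, v24, v26, v54] at this
    linear_combination this
  have v63 : W' (r 6) (c 3) = -1 := by
    have := hW.orth' (hr.ne (by decide : (6 : Fin 7) ≠ 0)) s0
    simp [y6, v02, v03, v62] at this
    linear_combination this
  have v64 : W' (r 6) (c 4) = -1 := by
    have := hW.orth' (hr.ne (by decide : (6 : Fin 7) ≠ 2)) s2
    simp [y6, v22, v24, v62] at this
    linear_combination -this
  have v65 : W' (r 6) (c 5) = 1 := by
    have := hW.orth' (hr.ne (by decide : (6 : Fin 7) ≠ 1)) s1
    simp [y6, v14, v15, v64] at this
    linear_combination this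
  refine Contains.of_scaled hs (Contains.of_eq r c hr hc ?_)
  simp [Fin.forall_fin_succ, W7, v00, v01, v02, v03, v14, v15, v26, v10, v20,
    v30, v41, v51, v62, v11, v22, v24, v33, v35, v36, v42, v45, v46, v53, v54, v56, v63, v64,
    v65]

theorem IsWeighing.contains_W8 [Fintype ι] [Fintype κ] {W : Matrix ι κ ℂ} (h : IsWeighing W)
    (hP : ContainsPattern W W8) : Contains W W8 := by
  obtain ⟨r, c, hr, hc, hB⟩ := hP
  simp [Fin.forall_fin_succ, W8] at hB
  obtain ⟨⟨a00, a01, a02, a03⟩, ⟨a10, a11, a14, a15⟩, ⟨a20, a22, a24, a26⟩,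
    ⟨a30, a33, a35, a36⟩, ⟨a41, a42, a44, a47⟩, ⟨a51, a53, a55, a57⟩, ⟨a62, a63, a66, a67⟩,
    ⟨a74, a75, a76, a77⟩⟩ := hB
  obtain ⟨s0, z0⟩ := h.supp_of_injective hc (r 0) 0 1 2 3 (by decide) a00 a01 a02 a03
  obtain ⟨s1, z1⟩ := h.supp_of_injective hc (r 1) 0 1 4 5 (by decide) a10 a11 a14 a15
  obtain ⟨s2, z2⟩ := h.supp_of_injective hc (r 2) 0 2 4 6 (by decide) a20 a22 a24 a26
  obtain ⟨s3, z3⟩ := h.supp_of_injective hc (r 3) 0 3 5 6 (by decide) a30 a33 a35 a36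
  obtain ⟨s4, z4⟩ := h.supp_of_injective hc (r 4) 1 2 4 7 (by decide) a41 a42 a44 a47
  obtain ⟨s5, z5⟩ := h.supp_of_injective hc (r 5) 1 3 5 7 (by decide) a51 a53 a55 a57
  obtain ⟨s6, z6⟩ := h.supp_of_injective hc (r 6) 2 3 6 7 (by decide) a62 a63 a66 a67
  obtain ⟨s7, z7⟩ := h.supp_of_injective hc (r 7) 4 5 6 7 (by decide) a74 a75 a76 a77
  obtain ⟨W', hs, hW, hz, p0, p1, p2, p3, q0, q1, q2, q3⟩ := h.exists_normalized
    (r 0) (r 1) (r 2) (r 4) (c 0) (c 1) (c 2) (c 4) a00 a01 a02 (Or.inl a10) (Or.inl a20)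
    (by tauto)
  replace s0 := s0.congr (hz (r 0))
  replace s1 := s1.congr (hz (r 1))
  replace s2 := s2.congr (hz (r 2))
  replace s3 := s3.congr (hz (r 3))
  replace s4 := s4.congr (hz (r 4))
  replace s5 := s5.congr (hz (r 5))
  replace s6 := s6.congr (hz (r 6))
  replace s7 := s7.congr (hz (r 7))
  have y0 := fun j h1 h2 h3 h4 => (hs.eq_zero_iff (r 0) (c j)).2 (z0 j h1 h2 h3 h4)
  have y1 := fun j h1 h2 h3 h4 => (hs.eq_zero_iff (r 1) (c j)).2 (z1 j h1 h2 h3 h4)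
  have y2 := fun j h1 h2 h3 h4 => (hs.eq_zero_iff (r 2) (c j)).2 (z2 j h1 h2 h3 h4)
  have y3 := fun j h1 h2 h3 h4 => (hs.eq_zero_iff (r 3) (c j)).2 (z3 j h1 h2 h3 h4)
  have y4 := fun j h1 h2 h3 h4 => (hs.eq_zero_iff (r 4) (c j)).2 (z4 j h1 h2 h3 h4)
  have y5 := fun j h1 h2 h3 h4 => (hs.eq_zero_iff (r 5) (c j)).2 (z5 j h1 h2 h3 h4)
  have y6 := fun j h1 h2 h3 h4 => (hs.eq_zero_iff (r 6) (c j)).2 (z6 j h1 h2 h3 h4)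
  have y7 := fun j h1 h2 h3 h4 => (hs.eq_zero_iff (r 7) (c j)).2 (z7 j h1 h2 h3 h4)
  have v00 : W' (r 0) (c 0) = 1 := p0 _  a00
  have v01 : W' (r 0) (c 1) = 1 := p0 _  a01
  have v02 : W' (r 0) (c 2) = 1 := p0 _  a02
  have v03 : W' (r 0) (c 3) = 1 := p0 _  a03
  have v14 : W' (r 1) (c 4) = 1 := p1 _ (z0 4 (by decide) (by decide) (by decide) (by decide)) a14
  have v15 : W' (r 1) (c 5) = 1 := p1 _ (z0 5 (by decide) (by decide) (by decide) (by decide)) a15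
  have v26 : W' (r 2) (c 6) = 1 := p2 _ (z0 6 (by decide) (by decide) (by decide) (by decide)) (z1 6 (by decide) (by decide) (by decide) (by decide)) a26
  have v47 : W' (r 4) (c 7) = 1 := p3 _ (z0 7 (by decide) (by decide) (by decide) (by decide)) (z1 7 (by decide) (by decide) (by decide) (by decide)) (z2 7 (by decide) (by decide) (by decide) (by decide)) a47
  have v10 : W' (r 1) (c 0) = 1 := q0 _  a10
  have v20 : W' (r 2) (c 0) = 1 := q0 _  a20
  have v30 : W' (r 3) (c 0) = 1 := q0 _  a30
  have v41 : W' (r 4) (c 1) = 1 := q1 _ (z4 0 (by decide) (by decide) (by decide) (by decide)) a41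
  have v51 : W' (r 5) (c 1) = 1 := q1 _ (z5 0 (by decide) (by decide) (by decide) (by decide)) a51
  have v62 : W' (r 6) (c 2) = 1 := q2 _ (z6 0 (by decide) (by decide) (by decide) (by decide)) (z6 1 (by decide) (by decide) (by decide) (by decide)) a62
  have v74 : W' (r 7) (c 4) = 1 := q3 _ (z7 0 (by decide) (by decide) (by decide) (by decide)) (z7 1 (by decide) (by decide) (by decide) (by decide)) (z7 2 (by decide) (by decide) (by decide) (by decide)) a74
  have v11 : W' (r 1) (c 1) = -1 := by
    have := hW.orth' (hr.ne (by decide : (1 : Fin 8) ≠ 0)) s0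
    simp [y1, v00, v01, v10] at this
    linear_combination this
  have v22 : W' (r 2) (c 2) = -1 := by
    have := hW.orth' (hr.ne (by decide : (2 : Fin 8) ≠ 0)) s0
    simp [y2, v00, v02, v20] at this
    linear_combination this
  have v24 : W' (r 2) (c 4) = -1 := by
    have := hW.orth' (hr.ne (by decide : (2 : Fin 8) ≠ 1)) s1
    simp [y2, v10, v14, v20] at this
    linear_combination this
  have v33 : W' (r 3) (c 3) = -1 := by
    have := hW.orth' (hr.ne (by decide : (3 : Fin 8) ≠ 0)) s0
    simp [y3, v00, v03, v30] at this
    linear_combination this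
  have v35 : W' (r 3) (c 5) = -1 := by
    have := hW.orth' (hr.ne (by decide : (3 : Fin 8) ≠ 1)) s1
    simp [y3, v10, v15, v30] at this
    linear_combination this
  have v36 : W' (r 3) (c 6) = -1 := by
    have := hW.orth' (hr.ne (by decide : (3 : Fin 8) ≠ 2)) s2
    simp [y3, v20, v26, v30] at this
    linear_combination this
  have v42 : W' (r 4) (c 2) = -1 := by
    have := hW.orth' (hr.ne (by decide : (4 : Fin 8) ≠ 0)) s0
    simp [y4, v01, v02, v41] at this
    linear_combination this
  have v44 : W' (r 4) (c 4) = 1 := by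
    have := hW.orth' (hr.ne (by decide : (4 : Fin 8) ≠ 1)) s1
    simp [y4, v11, v14, v41] at this
    linear_combination this
  have v53 : W' (r 5) (c 3) = -1 := by
    have := hW.orth' (hr.ne (by decide : (5 : Fin 8) ≠ 0)) s0
    simp [y5, v01, v03, v51] at this
    linear_combination this
  have v55 : W' (r 5) (c 5) = 1 := by
    have := hW.orth' (hr.ne (by decide : (5 : Fin 8) ≠ 1)) s1
    simp [y5, v11, v15, v51] at this
    linear_combination this
  have v57 : W' (r 5) (c 7) = -1 := by
    have := hW.orth' (hr.ne (by decide : (5 : Fin 8) ≠ 4)) s4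
    simp [y5, v41, v47, v51] at this
    linear_combination this
  have v63 : W' (r 6) (c 3) = -1 := by
    have := hW.orth' (hr.ne (by decide : (6 : Fin 8) ≠ 0)) s0
    simp [y6, v02, v03, v62] at this
    linear_combination this
  have v66 : W' (r 6) (c 6) = 1 := by
    have := hW.orth' (hr.ne (by decide : (6 : Fin 8) ≠ 2)) s2
    simp [y6, v22, v26, v62] at this
    linear_combination this
  have v67 : W' (r 6) (c 7) = 1 := by
    have := hW.orth' (hr.ne (by decide : (6 : Fin 8) ≠ 4)) s4
    simp [y6, v42, v47, v62] at this
    linear_combination this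
  have v75 : W' (r 7) (c 5) = -1 := by
    have := hW.orth' (hr.ne (by decide : (7 : Fin 8) ≠ 1)) s1
    simp [y7, v14, v15, v74] at this
    linear_combination this
  have v76 : W' (r 7) (c 6) = 1 := by
    have := hW.orth' (hr.ne (by decide : (7 : Fin 8) ≠ 2)) s2
    simp [y7, v24, v26, v74] at this
    linear_combination this
  have v77 : W' (r 7) (c 7) = -1 := by
    have := hW.orth' (hr.ne (by decide : (7 : Fin 8) ≠ 4)) s4
    simp [y7, v44, v47, v74] at this
    linear_combination this
  refine Contains.of_scaled hs (Contains.of_eq r c hr hc ?_)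
  simp [Fin.forall_fin_succ, W8, v00, v01, v02, v03, v14, v15, v26, v47, v10,
    v20, v30, v41, v51, v62, v74, v11, v22, v24, v33, v35, v36, v42, v44, v53, v55, v57, v63,
    v66, v67, v75, v76, v77]

end

section

variable {ι κ : Type}

/-! ### Vanishing sums of unimodular numbers -/

theorem star_a : star a = a' := rfl

theorem star_a' : star a' = a := star_star a

theorem norm_a : ‖a‖ = 1 := by
  have : (2 * Real.pi * Complex.I / 3 : ℂ) = ((2 * Real.pi / 3 : ℝ) : ℂ) * Complex.I := by
    push_cast; ring
  rw [a, this, Complex.norm_exp_ofReal_mul_I]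

theorem norm_a' : ‖a'‖ = 1 := by
  rw [← star_a, norm_star, norm_a]

theorem a_mul_a' : a * a' = 1 := mul_star_of_norm norm_a

theorem a_add_a' : a + a' = -1 := by
  have h3 : a ^ 3 = 1 := by
    rw [a, ← Complex.exp_nat_mul, ← Complex.exp_two_pi_mul_I]
    congr 1; push_cast; ring
  have h1 : a ≠ 1 := by
    intro h
    rw [a, Complex.exp_eq_one_iff] at h
    obtain ⟨n, hn⟩ := h
    have hpi : (2 * Real.pi * Complex.I : ℂ) ≠ 0 := by
      simp [Real.pi_ne_zero]
    have : (2 * Real.pi * Complex.I : ℂ) * (3 * n - 1) = 0 := by linear_combination -3 * hn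
    have h2 := (mul_eq_zero.1 this).resolve_left hpi
    have h4 : (3 * n - 1 : ℤ) = 0 := by exact_mod_cast h2
    omega
  have h2 : a ^ 2 + a + 1 = 0 := by
    have : (a - 1) * (a ^ 2 + a + 1) = 0 := by linear_combination h3
    exact (mul_eq_zero.1 this).resolve_left (sub_ne_zero.2 h1)
  linear_combination a' * h2 - (a + 1) * a_mul_a'

theorem a_sq : a * a = a' := by
  linear_combination a * a_add_a' - a_mul_a' - a_add_a'

theorem a'_sq : a' * a' = a := by
  linear_combination a' * a_add_a' - a_mul_a' - a_add_a'

theorem three_sum {p q : ℂ} (hp : ‖p‖ = 1) (hq : ‖q‖ = 1) (h : 1 + p + q = 0) :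
    p = a ∧ q = a' ∨ p = a' ∧ q = a := by
  have hs : 1 + star p + star q = 0 := by simpa using congrArg star h
  have h1 : p * q = 1 := by
    linear_combination p * q * hs - q * mul_star_of_norm hp - p * mul_star_of_norm hq - h
  have h2 : (p - a) * (p - a') = 0 := by
    linear_combination p * h - h1 - p * a_add_a' + a_mul_a'
  rcases mul_eq_zero.1 h2 with h3 | h3
  · left; exact ⟨by linear_combination h3, by linear_combination h - h3 - a_add_a'⟩
  · right; exact ⟨by linear_combination h3, by linear_combination h - h3 - a_add_a'⟩

theorem four_sum {p q r : ℂ} (hp : ‖p‖ = 1) (hq : ‖q‖ = 1) (hr : ‖r‖ = 1)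
    (h : 1 + p + q + r = 0) : p = -1 ∨ q = -1 ∨ r = -1 := by
  have hs : 1 + star p + star q + star r = 0 := by simpa using congrArg star h
  have h1 : (p + 1) * ((q + 1) * (r + 1)) = 0 := by
    linear_combination p * q * r * hs + h - q * r * mul_star_of_norm hp
      - p * r * mul_star_of_norm hq - p * q * mul_star_of_norm hr
  rcases mul_eq_zero.1 h1 with h2 | h2
  · exact Or.inl (by linear_combination h2)
  rcases mul_eq_zero.1 h2 with h2 | h2
  · exact Or.inr (Or.inl (by linear_combination h2))
  · exact Or.inr (Or.inr (by linear_combination h2))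

theorem parallelogram (x y : ℂ) : ‖x + y‖ ^ 2 + ‖x - y‖ ^ 2 = 2 * (‖x‖ ^ 2 + ‖y‖ ^ 2) := by
  have := parallelogram_law_with_norm ℝ x y
  linear_combination this

/-- Parseval's identity for the Fourier matrix of order three. -/
theorem parseval (t u v : ℂ) :
    ‖t + u + v‖ ^ 2 + ‖t + a' * u + a * v‖ ^ 2 + ‖t + a * u + a' * v‖ ^ 2
      = 3 * (‖t‖ ^ 2 + ‖u‖ ^ 2 + ‖v‖ ^ 2) := by
  have key : ∀ z : ℂ, ((‖z‖ ^ 2 : ℝ) : ℂ) = z * star z := fun z => by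
    rw [Complex.star_def, Complex.mul_conj, Complex.normSq_eq_norm_sq]
  apply Complex.ofReal_injective
  push_cast [key]
  simp only [star_add, star_mul', star_a, star_a']
  linear_combination (2 * u * star u + 2 * v * star v) * a_mul_a'
    + (t * star u + t * star v + u * star t + v * star t) * a_add_a'
    + (u * star v + v * star u) * (a_sq + a'_sq + a_add_a')

/-! ### Two lines with the same support -/

/-- Some `2 × 2` submatrix without zero entries is singular. -/
def HasSingular (W : Matrix ι κ ℂ) : Prop :=
  ∃ i i' j j', i ≠ i' ∧ j ≠ j' ∧ W i j ≠ 0 ∧ W i j' ≠ 0 ∧ W i' j ≠ 0 ∧ W i' j' ≠ 0 ∧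
    W i j * W i' j' = W i j' * W i' j

theorem HasSingular.of_transpose {W : Matrix ι κ ℂ} (h : HasSingular Wᵀ) : HasSingular W := by
  obtain ⟨j, j', i, i', hj, hi, h1, h2, h3, h4, h5⟩ := h
  exact ⟨i, i', j, j', hi, hj, h1, h3, h2, h4, by simpa [mul_comm] using h5⟩

theorem Scaled.ratio {W W' : Matrix ι κ ℂ} (hs : Scaled W W') {α : ℂ} {i i' : ι} {j j' : κ} :
    W' i j * W' i' j' = α * (W' i j' * W' i' j) ↔ W i j * W i' j' = α * (W i j' * W i' j) := by
  obtain ⟨ρ, γ, hρ, hγ, hs⟩ := hs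
  have : ρ i * ρ i' * γ j * γ j' ≠ 0 := by
    simp [ne_zero_of_norm (hρ _), ne_zero_of_norm (hγ _)]
  rw [hs, hs, hs, hs]
  exact ⟨fun h => mul_left_cancel₀ this (by linear_combination h),
    fun h => by linear_combination ρ i * ρ i' * γ j * γ j' * h⟩

theorem HasSingular.of_scaled {W W' : Matrix ι κ ℂ} (hs : Scaled W W') (h : HasSingular W') :
    HasSingular W := by
  obtain ⟨i, i', j, j', hi, hj, h1, h2, h3, h4, h5⟩ := h
  have hz := fun i j => not_congr (hs.eq_zero_iff i j)
  rw [← one_mul (_ * W' i' j), hs.ratio, one_mul] at h5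
  exact ⟨i, i', j, j', hi, hj, (hz _ _).1 h1, (hz _ _).1 h2, (hz _ _).1 h3, (hz _ _).1 h4, h5⟩

theorem Supp.swap {f : κ → ℂ} {x y z t : κ} (h : Supp f x y z t) : Supp f x z y t := by
  obtain ⟨⟨h1, h2, h3, h4, h5, h6⟩, hs⟩ := h
  exact ⟨⟨h2, h1, h3, h4.symm, h6, h5⟩, fun j => by rw [hs]; tauto⟩

theorem Supp.swap' {f : κ → ℂ} {x y z t : κ} (h : Supp f x y z t) : Supp f x t z y := by
  obtain ⟨⟨h1, h2, h3, h4, h5, h6⟩, hs⟩ := h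
  exact ⟨⟨h3, h2, h1, h6.symm, h5.symm, h4.symm⟩, fun j => by rw [hs]; tauto⟩

section Fintype

variable [Fintype ι] [Fintype κ] {W : Matrix ι κ ℂ}

/-- The rows `i = (1, 1, 1, 1)` and `i' = (1, -1, w, -w)` have the same support.  Unless `w = ±1`,
which gives a singular submatrix at once, a third row through column `x` has full support too, and
a singular submatrix appears in the three rows. -/
theorem IsWeighing.hasSingular_aux (h : IsWeighing W) {i i' : ι} (hi : i ≠ i') {x y z t : κ}
    (hs : Supp (W i) x y z t) (hs' : Supp (W i') x y z t)
    (h1 : ∀ j, W i j ≠ 0 → W i j = 1) (hx : ∀ i, W i x ≠ 0 → W i x = 1) (hy : W i' y = -1) :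
    HasSingular W := by
  by_contra hS
  have hS' : ∀ k k' c c', k ≠ k' → c ≠ c' → W k c ≠ 0 → W k c' ≠ 0 → W k' c ≠ 0 → W k' c' ≠ 0 →
      W k c * W k' c' ≠ W k c' * W k' c := fun k k' c c' g1 g2 g3 g4 g5 g6 g7 =>
    hS ⟨k, k', c, c', g1, g2, g3, g4, g5, g6, g7⟩
  obtain ⟨n1, n2, n3, n4⟩ := hs.ne_zero
  obtain ⟨m1, m2, m3, m4⟩ := hs'.ne_zero
  have e1 := h1 x n1
  have e2 := h1 y n2
  have e3 := h1 z n3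
  have e4 := h1 t n4
  have f1 := hx i' m1
  obtain ⟨⟨d1, d2, d3, d4, d5, d6⟩, -⟩ := id hs
  obtain ⟨R, R', hR⟩ := h.transpose.supp_two x hi n1 m1
  obtain ⟨⟨-, k1, -, k2, -, -⟩, -⟩ := id hR
  have hRx : W R x ≠ 0 := hR.ne_zero.2.2.1
  have g1 := hx R hRx
  have o1 := h.orth' hi.symm hs
  have o2 := h.orth' k1.symm hs
  have o3 := h.orth' k2.symm hs'
  set w := W i' z with hw
  have f4 : W i' t = -w := by
    simp [e1, e2, e3, e4, f1, hy] at o1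
    linear_combination o1
  have wn : ‖w‖ = 1 := h.norm m3
  have ww := mul_star_of_norm wn
  simp only [e1, e2, e3, e4, f1, hy, f4, g1, star_one, star_neg, mul_one] at o2 o3
  have w1 : w ≠ 1 := by
    have := hS' i i' x z hi d2 n1 n3 m1 m3
    rwa [e1, e3, f1, ← hw, one_mul, one_mul] at this
  have w2 : w ≠ -1 := by
    have := hS' i i' x t hi d3 n1 n4 m1 m4
    rw [e1, e4, f1, f4, one_mul, one_mul] at this
    exact fun h => this (by rw [h, neg_neg])
  have hp := h.entry R y
  have hq := h.entry R z
  have hr := h.entry R t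
  set p := W R y with hpd
  set q := W R z with hqd
  set r := W R t with hrd
  -- the entries of `R` satisfy `1 + |p|² = |q|² + |r|²`
  have par : 1 + ‖p‖ ^ 2 = ‖q‖ ^ 2 + ‖r‖ ^ 2 := by
    have a1 := parallelogram q r
    have a2 := parallelogram 1 p
    have a3 : ‖q + r‖ = ‖1 + p‖ := by
      rw [← norm_neg (1 + p)]; congr 1; linear_combination o2
    have a4 : ‖q - r‖ = ‖1 - p‖ := by
      have : q - r = -w * (1 - p) := by linear_combination w * o3 - (q - r) * ww
      rw [this, norm_mul, norm_neg, wn, one_mul]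
    rw [a3, a4, a2, norm_one] at a1
    linarith
  rcases hp with hp | hp
  · rcases hq with hq | hq <;> rcases hr with hr | hr
    · simp [hp, hq, hr] at par
    · apply w2
      simp only [hp, hq] at o2 o3
      linear_combination w * o3 + w * star w * o2 - ww
    · apply w1
      simp only [hp, hr] at o2 o3
      linear_combination w * o3 - w * star w * o2 + ww
    · norm_num [hp, hq, hr] at par
  · have hqr : q ≠ 0 ∧ r ≠ 0 := by
      constructor
      · intro h0
        rcases hr with hr | hr <;> norm_num [hp, h0, hr] at par
      · intro h0
        rcases hq with hq | hq <;> norm_num [hp, h0, hq] at par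
    have hq := hq.resolve_left hqr.1
    have hr := hr.resolve_left hqr.2
    have hp0 := ne_zero_of_norm hp
    have p1 : p ≠ 1 := by
      have := hS' i R x y k1 d1 n1 n2 hRx hp0
      rwa [e1, e2, g1, ← hpd, one_mul, one_mul] at this
    rcases four_sum hp hq hr o2 with h2 | h2 | h2
    · have := hS' i' R x y k2 d1 m1 m2 hRx hp0
      rw [f1, hy, g1, ← hpd, h2] at this
      exact this (by ring)
    · have : (w - 1) * (1 - p) = 0 := by
        simp only [h2] at o2 o3
        linear_combination w * o3 + w * star w * o2 + (1 - p) * ww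
      rcases mul_eq_zero.1 this with h3 | h3
      · exact w1 (by linear_combination h3)
      · exact p1 (by linear_combination -h3)
    · have : (w + 1) * (1 - p) = 0 := by
        simp only [h2] at o2 o3
        linear_combination w * o3 - w * star w * o2 - (1 - p) * ww
      rcases mul_eq_zero.1 this with h3 | h3
      · exact w2 (by linear_combination h3)
      · exact p1 (by linear_combination -h3)

/-- If two rows have the same support, then there is a singular `2 × 2` submatrix without zeros. -/
theorem IsWeighing.hasSingular_of_supp (h : IsWeighing W) {i i' : ι} (hi : i ≠ i') {x y z t : κ}
    (hs : Supp (W i) x y z t) (hs' : Supp (W i') x y z t) : HasSingular W := by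
  obtain ⟨n1, n2, n3, n4⟩ := hs.ne_zero
  obtain ⟨m1, m2, m3, m4⟩ := hs'.ne_zero
  obtain ⟨W', sc, hW, hz, p0, -, -, -, q0, -, -, -⟩ := h.exists_normalized i i i i x y z t n1 n2 n3
    (Or.inl n1) (Or.inl n1) (Or.inl n1)
  refine HasSingular.of_scaled sc ?_
  replace hs := hs.congr (hz i)
  replace hs' := hs'.congr (hz i')
  have hp : ∀ j, W' i j ≠ 0 → W' i j = 1 := fun j hj => p0 j ((hz _ _).1 hj)
  have hq : ∀ i, W' i x ≠ 0 → W' i x = 1 := fun j hj => q0 j ((hz _ _).1 hj)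
  have o := hW.orth' hi.symm hs
  rw [p0 x n1, p0 y n2, p0 z n3, p0 t n4, q0 i' m1] at o
  obtain ⟨m1, m2, m3, m4⟩ := hs'.ne_zero
  rcases four_sum (hW.norm m2) (hW.norm m3) (hW.norm m4) (by simpa using o) with h1 | h1 | h1
  · exact hW.hasSingular_aux hi hs hs' hp hq h1
  · exact hW.hasSingular_aux hi hs.swap hs'.swap hp hq h1
  · exact hW.hasSingular_aux hi hs.swap' hs'.swap' hp hq h1

end Fintype

end

section

variable {ι κ : Type}

/-! ### Two lines sharing three positions: the blocks of orders five and six -/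

theorem injective_five {α : Type} {x0 x1 x2 x3 x4 : α} (h : [x0, x1, x2, x3, x4].Nodup) :
    Function.Injective ![x0, x1, x2, x3, x4] := by
  have := List.nodup_iff_injective_get.1 h
  intro i j hij
  apply this
  fin_cases i <;> fin_cases j <;> exact hij

theorem injective_six {α : Type} {x0 x1 x2 x3 x4 x5 : α} (h : [x0, x1, x2, x3, x4, x5].Nodup) :
    Function.Injective ![x0, x1, x2, x3, x4, x5] := by
  have := List.nodup_iff_injective_get.1 h
  intro i j hij
  apply this
  fin_cases i <;> fin_cases j <;> exact hij

/-- If `1 + v` and `1 + a' v` are both unimodular, then `v = a'`. -/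
theorem two_sums {v p q : ℂ} (hv : ‖v‖ = 1) (hp : ‖p‖ = 1) (hq : ‖q‖ = 1) (h1 : 1 + v + p = 0)
    (h2 : 1 + a' * v + q = 0) : v = a' ∧ p = a ∧ q = a' := by
  rcases three_sum hv hp h1 with ⟨rfl, -⟩ | ⟨rfl, rfl⟩
  · have : q = -2 := by linear_combination h2 - a_mul_a'
    norm_num [this] at hq
  · exact ⟨rfl, rfl, by linear_combination h2 - a'_sq - a_add_a'⟩

/-- If `1 + v` and `1 + a v` are both unimodular, then `v = a`. -/
theorem two_sums' {v p q : ℂ} (hv : ‖v‖ = 1) (hp : ‖p‖ = 1) (hq : ‖q‖ = 1) (h1 : 1 + v + p = 0)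
    (h2 : 1 + a * v + q = 0) : v = a ∧ p = a' ∧ q = a := by
  rcases three_sum hv hp h1 with ⟨rfl, rfl⟩ | ⟨rfl, -⟩
  · exact ⟨rfl, rfl, by linear_combination h2 - a_sq - a_add_a'⟩
  · have : q = -2 := by linear_combination h2 - a_mul_a'
    norm_num [this] at hq

theorem ne_zero_of_parseval {X Y Z T S N : ℝ} (hX : X = 0 ∨ X = 1) (hY : Y = 0 ∨ Y = 1)
    (hZ : Z = 0 ∨ Z = 1) (hT : T = 0 ∨ T = 1) (hS : S = 0 ∨ S = 1)
    (hP : T ^ 2 + S ^ 2 + N = 3 * (X ^ 2 + Y ^ 2 + Z ^ 2)) (hN : N ≤ (X + Y + Z) ^ 2)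
    (h1 : ¬X = 0 ∨ ¬Y = 0 ∨ ¬Z = 0) (h2 : X = 0 ∨ Y = 0 ∨ Z = 0) : ¬T = 0 ∧ ¬S = 0 := by
  rcases hX with rfl | rfl <;> rcases hY with rfl | rfl <;> rcases hZ with rfl | rfl <;>
    rcases hT with rfl | rfl <;> rcases hS with rfl | rfl <;> norm_num at * <;> linarith

variable {W : Matrix ι κ ℂ}

/-- The rows `r1` and `r2` share exactly the columns `x, y, z`; the entries in these columns have
the ratios `1, a, a'`. -/
structure ShareThree (W : Matrix ι κ ℂ) (r1 r2 : ι) (x y z t s : κ) : Prop where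
  ne : r1 ≠ r2
  supp1 : Supp (W r1) x y z t
  supp2 : Supp (W r2) x y z s
  ts : t ≠ s
  ratio : W r1 x * W r2 y = a * (W r1 y * W r2 x)

theorem ShareThree.scaled {W' : Matrix ι κ ℂ} {r1 r2 : ι} {x y z t s : κ}
    (h : ShareThree W r1 r2 x y z t s) (hs : Scaled W W') : ShareThree W' r1 r2 x y z t s :=
  ⟨h.ne, h.supp1.congr fun j => not_congr (hs.eq_zero_iff r1 j),
    h.supp2.congr fun j => not_congr (hs.eq_zero_iff r2 j), h.ts, hs.ratio.2 h.ratio⟩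

theorem ShareThree.r2t {r1 r2 : ι} {x y z t s : κ} (h : ShareThree W r1 r2 x y z t s) :
    W r2 t = 0 :=
  have hd := h.supp1.1
  h.supp2.eq_zero hd.2.2.1.symm hd.2.2.2.2.1.symm hd.2.2.2.2.2.symm h.ts

theorem ShareThree.r1s {r1 r2 : ι} {x y z t s : κ} (h : ShareThree W r1 r2 x y z t s) :
    W r1 s = 0 :=
  have hd := h.supp2.1
  h.supp1.eq_zero hd.2.2.1.symm hd.2.2.2.2.1.symm hd.2.2.2.2.2.symm h.ts.symm

/-- Normalized form of `ShareThree`: the rows are `1 1 1 1 0` and `1 a a' 0 1`. -/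
structure ShareThreeNormal (W : Matrix ι κ ℂ) (r1 r2 : ι) (x y z t s : κ) : Prop
    extends ShareThree W r1 r2 x y z t s where
  v1x : W r1 x = 1
  v1y : W r1 y = 1
  v1z : W r1 z = 1
  v1t : W r1 t = 1
  v2x : W r2 x = 1
  v2y : W r2 y = a
  v2z : W r2 z = a'
  v2s : W r2 s = 1

theorem IsWeighing.shareThreeNormal [Fintype ι] [Fintype κ] (h : IsWeighing W) {r1 r2 : ι} {x y z t s : κ}
    (hS : ShareThree W r1 r2 x y z t s) (h1 : ∀ j, W r1 j ≠ 0 → W r1 j = 1) (h2 : W r2 x = 1)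
    (h3 : W r2 s = 1) : ShareThreeNormal W r1 r2 x y z t s := by
  obtain ⟨n1, n2, n3, n4⟩ := hS.supp1.ne_zero
  have e1 := h1 x n1
  have e2 := h1 y n2
  have e3 := h1 z n3
  have e4 := h1 t n4
  have e5 : W r2 y = a := by
    have := hS.ratio
    rw [e1, e2, h2] at this
    linear_combination this
  refine ⟨hS, e1, e2, e3, e4, h2, e5, ?_, h3⟩
  have o := h.orth hS.ne hS.supp1
  simp only [e1, e2, e3, e4, h2, e5, hS.r2t, star_one, star_zero, one_mul, add_zero, star_a] at o
  have := congrArg star o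
  simp only [star_add, star_one, star_a', star_star, star_zero] at this
  linear_combination this - a_add_a'

namespace ShareThreeNormal

variable {r1 r2 : ι} {x y z t s : κ}

theorem orth1 [Fintype ι] [Fintype κ] (hS : ShareThreeNormal W r1 r2 x y z t s) (h : IsWeighing W) {r : ι} (hr : r ≠ r1) :
    W r x + W r y + W r z + W r t = 0 := by
  simpa [hS.v1x, hS.v1y, hS.v1z, hS.v1t] using h.orth' hr hS.supp1

theorem orth2 [Fintype ι] [Fintype κ] (hS : ShareThreeNormal W r1 r2 x y z t s) (h : IsWeighing W) {r : ι} (hr : r ≠ r2) :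
    W r x + a' * W r y + a * W r z + W r s = 0 := by
  have := h.orth' hr hS.supp2
  simp only [hS.v2x, hS.v2y, hS.v2z, hS.v2s, star_one, star_a, star_a'] at this
  linear_combination this

/-- A row other than `r1` and `r2` which meets some but not all of the shared columns also meets
the two remaining columns of `r1` and `r2`. -/
theorem meets [Fintype ι] [Fintype κ] (hS : ShareThreeNormal W r1 r2 x y z t s) (h : IsWeighing W) {r : ι} (h1 : r ≠ r1)
    (h2 : r ≠ r2) (hn : W r x ≠ 0 ∨ W r y ≠ 0 ∨ W r z ≠ 0)
    (hz : W r x = 0 ∨ W r y = 0 ∨ W r z = 0) : W r t ≠ 0 ∧ W r s ≠ 0 := by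
  have o1 : ‖W r x + W r y + W r z‖ = ‖W r t‖ := by
    rw [← norm_neg (W r t)]; congr 1; linear_combination hS.orth1 h h1
  have o2 : ‖W r x + a' * W r y + a * W r z‖ = ‖W r s‖ := by
    rw [← norm_neg (W r s)]; congr 1; linear_combination hS.orth2 h h2
  have P := parseval (W r x) (W r y) (W r z)
  rw [o1, o2] at P
  have T : ‖W r x + a * W r y + a' * W r z‖ ≤ ‖W r x‖ + ‖W r y‖ + ‖W r z‖ := by
    refine (norm_add₃_le).trans ?_
    simp [norm_a, norm_a']
  have T2 : ‖W r x + a * W r y + a' * W r z‖ ^ 2 ≤ (‖W r x‖ + ‖W r y‖ + ‖W r z‖) ^ 2 :=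
    pow_le_pow_left₀ (norm_nonneg _) T 2
  have key : ∀ j, ‖W r j‖ = 0 ∨ ‖W r j‖ = 1 := fun j => by
    rcases h.entry r j with h | h
    · left; rw [h, norm_zero]
    · exact Or.inr h
  -- with `n` shared columns met, `3 n ≤ |p|² + |q|² + n²` for the remaining two entries `p, q`
  have nz : ∀ j, W r j = 0 ↔ ‖W r j‖ = 0 := fun j => norm_eq_zero.symm
  simp only [ne_eq, nz] at hn hz ⊢
  exact ne_zero_of_parseval (key x) (key y) (key z) (key t) (key s) P T2 hn hz

theorem contains_W5_aux [Fintype ι] [Fintype κ] (hS : ShareThreeNormal W r1 r2 x y z t s)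
    (h : IsWeighing W) {p q k : ι} (hr : [r1, r2, p, q, k].Nodup) (hc : [x, y, z, t, s].Nodup)
    (px : W p x = 1) (py : W p y ≠ 0) (pz : W p z = 0) (pt : W p t ≠ 0) (ps : W p s ≠ 0)
    (qx : W q x = 1) (qy : W q y = 0) (qz : W q z ≠ 0) (qt : W q t ≠ 0) (qs : W q s ≠ 0)
    (kx : W k x = 0) (ky : W k y = 1) (kz : W k z ≠ 0) (kt : W k t ≠ 0) (ks : W k s ≠ 0) :
    Contains W W5 := by
  obtain ⟨⟨-, e1, e2, e3⟩, ⟨e4, e5, e6⟩, -⟩ :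
      (r1 ≠ r2 ∧ r1 ≠ p ∧ r1 ≠ q ∧ r1 ≠ k) ∧ (r2 ≠ p ∧ r2 ≠ q ∧ r2 ≠ k) ∧ True := by
    simp at hr ⊢; tauto
  have hp1 := hS.orth1 h e1.symm
  have hp2 := hS.orth2 h e4.symm
  have hq1 := hS.orth1 h e2.symm
  have hq2 := hS.orth2 h e5.symm
  have hk1 := hS.orth1 h e3.symm
  have hk2 := hS.orth2 h e6.symm
  simp only [px, pz, qx, qy, kx, ky, mul_one, mul_zero, zero_add, add_zero]
    at hp1 hp2 hq1 hq2 hk1 hk2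
  -- in each row both relations are sums of three unimodular numbers, which determines the row
  obtain ⟨p1, p2, p3⟩ := two_sums (h.norm py) (h.norm pt) (h.norm ps) hp1 hp2
  obtain ⟨q1, q2, q3⟩ := two_sums' (h.norm qz) (h.norm qt) (h.norm qs) hq1 hq2
  obtain ⟨k1, k2, k3⟩ := two_sums (h.norm kz) (h.norm kt)
    (show ‖a * W k s‖ = 1 by simp [norm_a, h.norm ks]) hk1
    (by linear_combination a * hk2 - a_mul_a' - W k z * a_sq)
  have k4 : W k s = a := by linear_combination a' * k3 - W k s * a_mul_a' + a'_sq
  refine Contains.of_eq ![r1, r2, p, q, k] ![x, y, z, t, s] (injective_five hr)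
    (injective_five hc) ?_
  simp [Fin.forall_fin_succ, W5, hS.v1x, hS.v1y, hS.v1z, hS.v1t, hS.v2x, hS.v2y, hS.v2z, hS.v2s,
    *]

/-- The rows of `W₅` are `r1`, `r2`, the two other rows `p`, `q` through column `x`, and the fourth
row through column `t`. -/
theorem contains_W5_of_row [Fintype ι] [Fintype κ] (hS : ShareThreeNormal W r1 r2 x y z t s)
    (h : IsWeighing W) (hx : ∀ r, W r x ≠ 0 → W r x = 1)
    (hy : ∀ r, W r x = 0 → W r y ≠ 0 → W r y = 1)
    (hn : ∀ r, r ≠ r1 → r ≠ r2 → W r x = 0 ∨ W r y = 0 ∨ W r z = 0) {p q : ι}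
    (hpq : Supp (Wᵀ x) r1 r2 p q) (py : W p y ≠ 0) : Contains W W5 := by
  obtain ⟨⟨-, p1, q1, p2, q2, npq⟩, -⟩ := id hpq
  obtain ⟨⟨n1, n2, n3, n4, n5, n6⟩, -⟩ := id hS.supp1
  obtain ⟨⟨-, -, n7, -, n8, n9⟩, -⟩ := id hS.supp2
  obtain ⟨-, b2, b3, b4⟩ := hS.supp1.ne_zero
  obtain ⟨-, d2, d3, d4⟩ := hS.supp2.ne_zero
  obtain ⟨-, -, px, qx⟩ := hpq.ne_zero
  obtain ⟨pt, ps⟩ := hS.meets h p1.symm p2.symm (Or.inl px) (hn p p1.symm p2.symm)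
  obtain ⟨qt, qs⟩ := hS.meets h q1.symm q2.symm (Or.inl qx) (hn q q1.symm q2.symm)
  obtain ⟨k, hk⟩ := h.transpose.supp_three t p1 q1 npq b4 pt qt
  obtain ⟨⟨-, -, k1, -, k3, k4⟩, hk⟩ := hk
  have k2 : r2 ≠ k := by
    rintro rfl
    exact (hk r2).2 (by simp) hS.r2t
  have kx : W k x = 0 := by
    by_contra h0
    rcases (hpq.2 k).1 h0 with e | e | e | e
    exacts [k1 e.symm, k2 e.symm, k3 e.symm, k4 e.symm]
  -- a further row through one of the shared columns contains column `t`, so it is `p`, `q` or `k`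
  have key : ∀ {r}, r ≠ r1 → r ≠ r2 → W r y ≠ 0 ∨ W r z ≠ 0 → r = p ∨ r = q ∨ r = k := by
    intro r g1 g2 g
    have := (hk r).1 (hS.meets h g1 g2 (Or.inr g) (hn r g1 g2)).1
    tauto
  have pz : W p z = 0 := by
    by_contra h0
    rcases hn p p1.symm p2.symm with e | e | e <;> contradiction
  obtain ⟨u, v, hu⟩ := h.transpose.supp_two z hS.ne b3 d3
  obtain ⟨-, -, uz, vz⟩ := hu.ne_zero
  obtain ⟨⟨-, u1, v1, u2, v2, nuv⟩, -⟩ := hu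
  have up : u ≠ p := by rintro rfl; exact uz pz
  have vp : v ≠ p := by rintro rfl; exact vz pz
  have qkz : W q z ≠ 0 ∧ W k z ≠ 0 := by
    rcases key u1.symm u2.symm (Or.inr uz) with e | rfl | rfl <;>
      rcases key v1.symm v2.symm (Or.inr vz) with e' | rfl | rfl <;>
      first | contradiction | exact ⟨uz, vz⟩ | exact ⟨vz, uz⟩
  have qy : W q y = 0 := by
    by_contra h0
    rcases hn q q1.symm q2.symm with e | e | e
    exacts [qx e, h0 e, qkz.1 e]
  obtain ⟨u', v', hu'⟩ := h.transpose.supp_two y hS.ne b2 d2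
  obtain ⟨-, -, uy, vy⟩ := hu'.ne_zero
  obtain ⟨⟨-, u1', v1', u2', v2', nuv'⟩, -⟩ := hu'
  have uq : u' ≠ q := by rintro rfl; exact uy qy
  have vq : v' ≠ q := by rintro rfl; exact vy qy
  have ky : W k y ≠ 0 := by
    rcases key u1'.symm u2'.symm (Or.inl uy) with rfl | e | rfl
    · rcases key v1'.symm v2'.symm (Or.inl vy) with e' | e' | rfl
      exacts [absurd e'.symm nuv', absurd e' vq, vy]
    · exact absurd e uq
    · exact uy
  obtain ⟨kt, ks⟩ := hS.meets h k1.symm k2.symm (Or.inr (Or.inl ky)) (hn k k1.symm k2.symm)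
  refine hS.contains_W5_aux h (p := p) (q := q) (k := k) ?_ ?_ (hx _ px) py pz pt ps (hx _ qx) qy
    qkz.1 qt qs kx (hy _ kx ky) qkz.2 kt ks
  · simp [hS.ne, p1, q1, k1, p2, q2, k2, npq, k3, k4]
  · simp [n1, n2, n3, n4, n5, n6, n7, n8, n9, hS.ts]

/-- If no third row contains the three shared columns, then there is a block of order five. -/
theorem contains_W5 [Fintype ι] [Fintype κ] (hS : ShareThreeNormal W r1 r2 x y z t s)
    (h : IsWeighing W) (hx : ∀ r, W r x ≠ 0 → W r x = 1)
    (hy : ∀ r, W r x = 0 → W r y ≠ 0 → W r y = 1)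
    (hn : ∀ r, r ≠ r1 → r ≠ r2 → W r x = 0 ∨ W r y = 0 ∨ W r z = 0) : Contains W W5 := by
  obtain ⟨b1, b2, -, b4⟩ := hS.supp1.ne_zero
  obtain ⟨d1, d2, -, -⟩ := hS.supp2.ne_zero
  obtain ⟨p, q, hpq⟩ := h.transpose.supp_two x hS.ne b1 d1
  by_cases py : W p y = 0
  · have hqp : Supp (Wᵀ x) r1 r2 q p := hpq.swap.swap'.swap
    refine hS.contains_W5_of_row h hx hy hn hqp fun qy => ?_
    -- otherwise three further rows besides `p` and `q` meet column `t`
    obtain ⟨-, -, px, qx⟩ := hpq.ne_zero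
    obtain ⟨⟨-, p1, q1, p2, q2, npq⟩, -⟩ := hpq
    have pt := (hS.meets h p1.symm p2.symm (Or.inl px) (hn p p1.symm p2.symm)).1
    have qt := (hS.meets h q1.symm q2.symm (Or.inl qx) (hn q q1.symm q2.symm)).1
    obtain ⟨k, -, hk⟩ := h.transpose.supp_three t p1 q1 npq b4 pt qt
    obtain ⟨u, v, hu⟩ := h.transpose.supp_two y hS.ne b2 d2
    obtain ⟨-, -, uy, vy⟩ := hu.ne_zero
    obtain ⟨⟨-, u1, v1, u2, v2, nuv⟩, -⟩ := hu
    have key : ∀ {r}, r ≠ r1 → r ≠ r2 → W r y ≠ 0 → r = k := by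
      intro r g1 g2 g
      rcases (hk r).1 (hS.meets h g1 g2 (Or.inr (Or.inl g)) (hn r g1 g2)).1 with
        e | rfl | rfl | e
      exacts [absurd e g1, absurd py g, absurd qy g, e]
    exact nuv ((key u1.symm u2.symm uy).trans (key v1.symm v2.symm vy).symm)
  · exact hS.contains_W5_of_row h hx hy hn hpq py

/-- If a third row contains the three shared columns, then there is a block of order six. -/
theorem contains_W6 [Fintype ι] [Fintype κ] (hS : ShareThreeNormal W r1 r2 x y z t s)
    (h : IsWeighing W) (hx : ∀ r, W r x ≠ 0 → W r x = 1)
    (hy : ∀ r, W r x = 0 → W r y ≠ 0 → W r y = 1)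
    (hz : ∀ r, W r x = 0 → W r y = 0 → W r z ≠ 0 → W r z = 1) {r3 : ι} {k : κ} (h31 : r3 ≠ r1)
    (h32 : r3 ≠ r2) (s3 : Supp (W r3) x y z k) (kt : k ≠ t) (ks : k ≠ s) (h3k : W r3 k = 1) :
    Contains W W6 := by
  obtain ⟨b1, b2, b3, b4⟩ := hS.supp1.ne_zero
  obtain ⟨c1, c2, c3, c4⟩ := hS.supp2.ne_zero
  obtain ⟨d1, d2, d3, d4⟩ := s3.ne_zero
  obtain ⟨⟨n1, n2, n3, n4, n5, n6⟩, -⟩ := id hS.supp1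
  obtain ⟨⟨-, -, n7, -, n8, n9⟩, -⟩ := id hS.supp2
  obtain ⟨⟨-, -, n10, -, n11, n12⟩, -⟩ := id s3
  have z3t : W r3 t = 0 := s3.eq_zero n3.symm n5.symm n6.symm kt.symm
  have z3s : W r3 s = 0 := s3.eq_zero n7.symm n8.symm n9.symm ks.symm
  have e1 := hx r3 d1
  have o1 := hS.orth1 h h31
  have o2 := hS.orth2 h h32
  rw [z3t, e1, add_zero] at o1
  rw [z3s, e1, add_zero] at o2
  have e23 : W r3 y = a' ∧ W r3 z = a := by
    rcases three_sum (h.norm d2) (h.norm d3) o1 with ⟨g1, g2⟩ | h'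
    · exfalso
      rw [g1, g2] at o2
      have : (3 : ℂ) = 0 := by linear_combination o2 - 2 * a_mul_a'
      norm_num at this
    · exact h'
  obtain ⟨e2, e3⟩ := e23
  have orth3 : ∀ {r}, r ≠ r3 → W r x + a * W r y + a' * W r z + W r k = 0 := by
    intro r hr
    have := h.orth' hr s3
    simp only [e1, e2, e3, h3k, star_one, star_a, star_a'] at this
    linear_combination this
  -- by Parseval's identity every further row meets at most one of the columns `x, y, z`
  have P : ∀ {r}, r ≠ r1 → r ≠ r2 → r ≠ r3 →
      3 * (‖W r x‖ ^ 2 + ‖W r y‖ ^ 2 + ‖W r z‖ ^ 2) ≤ 3 := by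
    intro r g1 g2 g3
    have q1 : ‖W r x + W r y + W r z‖ = ‖W r t‖ := by
      rw [← norm_neg (W r t)]; congr 1; linear_combination hS.orth1 h g1
    have q2 : ‖W r x + a' * W r y + a * W r z‖ = ‖W r s‖ := by
      rw [← norm_neg (W r s)]; congr 1; linear_combination hS.orth2 h g2
    have q3 : ‖W r x + a * W r y + a' * W r z‖ = ‖W r k‖ := by
      rw [← norm_neg (W r k)]; congr 1; linear_combination orth3 g3
    have le : ∀ j, ‖W r j‖ ^ 2 ≤ 1 := fun j => by
      rcases h.entry r j with e | e <;> simp [e]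
    rw [← parseval, q1, q2, q3]
    linarith [le t, le s, le k]
  have key : ∀ {r} {j j' : κ}, ‖W r j‖ ^ 2 + ‖W r j'‖ ^ 2 ≤ 1 → W r j ≠ 0 → W r j' = 0 := by
    intro r j j' hle hj
    rw [h.norm hj] at hle
    have : ‖W r j'‖ ^ 2 ≤ 0 := by linarith
    simpa using le_antisymm this (sq_nonneg _)
  have nn : ∀ r j, 0 ≤ ‖W r j‖ ^ 2 := fun r j => sq_nonneg _
  obtain ⟨p, ⟨-, -, p1, -, p2, p3⟩, hp⟩ :=
    h.transpose.supp_three x hS.ne h31.symm h32.symm b1 c1 d1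
  obtain ⟨q, ⟨-, -, q1, -, q2, q3⟩, hq⟩ :=
    h.transpose.supp_three y hS.ne h31.symm h32.symm b2 c2 d2
  obtain ⟨u, ⟨-, -, u1, -, u2, u3⟩, hu⟩ :=
    h.transpose.supp_three z hS.ne h31.symm h32.symm b3 c3 d3
  have px : W p x ≠ 0 := (hp p).2 (by simp)
  have qy : W q y ≠ 0 := (hq q).2 (by simp)
  have uz : W u z ≠ 0 := (hu u).2 (by simp)
  have Pp := P p1.symm p2.symm p3.symm
  have Pq := P q1.symm q2.symm q3.symm
  have Pu := P u1.symm u2.symm u3.symm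
  have py : W p y = 0 := key (by linarith [nn p z]) px
  have pz : W p z = 0 := key (by linarith [nn p y]) px
  have qx : W q x = 0 := key (by linarith [nn q z]) qy
  have qz : W q z = 0 := key (by linarith [nn q x]) qy
  have ux : W u x = 0 := key (by linarith [nn u y]) uz
  have uy : W u y = 0 := key (by linarith [nn u x]) uz
  have pq : p ≠ q := by rintro rfl; exact px qx
  have pu : p ≠ u := by rintro rfl; exact px ux
  have qu : q ≠ u := by rintro rfl; exact qy uy
  have vp := hx p px
  have vq := hy q qx qy
  have vu := hz u ux uy uz
  have p4 := hS.orth1 h p1.symm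
  have p5 := hS.orth2 h p2.symm
  have p6 := orth3 p3.symm
  have q4 := hS.orth1 h q1.symm
  have q5 := hS.orth2 h q2.symm
  have q6 := orth3 q3.symm
  have u4 := hS.orth1 h u1.symm
  have u5 := hS.orth2 h u2.symm
  have u6 := orth3 u3.symm
  simp only [vp, py, pz, qx, vq, qz, ux, uy, vu, mul_zero, mul_one, zero_add, add_zero]
    at p4 p5 p6 q4 q5 q6 u4 u5 u6
  replace p4 : W p t = -1 := by linear_combination p4
  replace p5 : W p s = -1 := by linear_combination p5
  replace p6 : W p k = -1 := by linear_combination p6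
  replace q4 : W q t = -1 := by linear_combination q4
  replace q5 : W q s = -a' := by linear_combination q5
  replace q6 : W q k = -a := by linear_combination q6
  replace u4 : W u t = -1 := by linear_combination u4
  replace u5 : W u s = -a := by linear_combination u5
  replace u6 : W u k = -a' := by linear_combination u6
  refine Contains.of_eq ![r1, r2, r3, p, q, u] ![x, y, z, t, s, k] (injective_six ?_)
    (injective_six ?_) ?_
  · simp [hS.ne, h31.symm, h32.symm, p1, p2, p3, q1, q2, q3, u1, u2, u3, pq, pu, qu]
  · simp [n1, n2, n3, n4, n5, n6, n7, n8, n9, n10, n11, n12, hS.ts, kt.symm, ks.symm]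
  · simp [Fin.forall_fin_succ, W6, hS.v1x, hS.v1y, hS.v1z, hS.v1t, hS.v2x, hS.v2y, hS.v2z, hS.v2s,
      e1, e2, e3, h3k, vp, vq, vu, p4, p5, p6, q4, q5, q6, u4, u5, u6]

end ShareThreeNormal

theorem IsWeighing.contains_of_shareThree [Fintype ι] [Fintype κ] (h : IsWeighing W)
    (hns : ¬HasSingular W) {r1 r2 : ι} {x y z t s : κ} (hS : ShareThree W r1 r2 x y z t s) :
    Contains W W5 ∨ Contains W W6 := by
  obtain ⟨b1, b2, b3, b4⟩ := hS.supp1.ne_zero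
  obtain ⟨c1, c2, c3, c4⟩ := hS.supp2.ne_zero
  obtain ⟨⟨n1, n2, n3, n4, n5, n6⟩, -⟩ := id hS.supp1
  by_cases hn : ∀ r, r ≠ r1 → r ≠ r2 → W r x = 0 ∨ W r y = 0 ∨ W r z = 0
  · left
    obtain ⟨W', sc, hW, hz, p0, p1, -, -, q0, q1, -, -⟩ := h.exists_normalized r1 r2 r1 r1 x y z x
      b1 b2 b3 (Or.inl c1) (Or.inl b1) (Or.inl b1)
    refine Contains.of_scaled sc ?_
    have hN := hW.shareThreeNormal (hS.scaled sc) (fun j hj => p0 j ((hz _ _).1 hj)) (q0 _ c1)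
      (p1 s hS.r1s c4)
    have hz' := sc.eq_zero_iff
    exact hN.contains_W5 hW (fun r hr => q0 r ((hz _ _).1 hr))
      (fun r hr hr' => q1 r ((hz' _ _).1 hr) ((hz _ _).1 hr')) (by simpa only [hz'] using hn)
  · right
    push Not at hn
    obtain ⟨r3, h31, h32, d1, d2, d3⟩ := hn
    obtain ⟨k, s3⟩ := h.supp_three r3 n1 n2 n4 d1 d2 d3
    have d4 := s3.ne_zero.2.2.2
    have kt : k ≠ t := by
      rintro rfl
      exact hns (h.hasSingular_of_supp h31 s3 hS.supp1)
    have ks : k ≠ s := by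
      rintro rfl
      exact hns (h.hasSingular_of_supp h32 s3 hS.supp2)
    obtain ⟨⟨-, -, n7, -, n8, n9⟩, -⟩ := id s3
    have k1 : W r1 k = 0 := hS.supp1.eq_zero n7.symm n8.symm n9.symm kt
    have k2 : W r2 k = 0 := hS.supp2.eq_zero n7.symm n8.symm n9.symm ks
    obtain ⟨W', sc, hW, hz, p0, p1, p2, -, q0, q1, q2, -⟩ := h.exists_normalized r1 r2 r3 r1 x y z x
      b1 b2 b3 (Or.inl c1) (Or.inl d1) (Or.inl b1)
    refine Contains.of_scaled sc ?_
    have hN := hW.shareThreeNormal (hS.scaled sc) (fun j hj => p0 j ((hz _ _).1 hj)) (q0 _ c1)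
      (p1 s hS.r1s c4)
    have hz' := sc.eq_zero_iff
    exact hN.contains_W6 hW (fun r hr => q0 r ((hz _ _).1 hr))
      (fun r hr hr' => q1 r ((hz' _ _).1 hr) ((hz _ _).1 hr'))
      (fun r hr hr' hr'' => q2 r ((hz' _ _).1 hr) ((hz' _ _).1 hr') ((hz _ _).1 hr''))
      h31 h32 (s3.congr (hz r3)) kt ks (p2 k k1 k2 d4)

/-- In a vanishing sum of three unimodular numbers `u ū'`, `v v̄'`, `w w̄'`, one of the last two is
`a'` times the first. -/
theorem three_sum_ratio {u v w u' v' w' : ℂ} (hu : ‖u‖ = 1) (hv : ‖v‖ = 1) (hw : ‖w‖ = 1)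
    (hu' : ‖u'‖ = 1) (hv' : ‖v'‖ = 1) (hw' : ‖w'‖ = 1)
    (h : u * star u' + v * star v' + w * star w' = 0) :
    u * v' = a * (v * u') ∨ u * w' = a * (w * u') := by
  have hp : ‖u * star u' * star v * v'‖ = 1 := by simp [*]
  have hq : ‖u * star u' * star w * w'‖ = 1 := by simp [*]
  have key : 1 + star (u * star u' * star v * v') + star (u * star u' * star w * w') = 0 := by
    simp only [star_mul', star_star]
    linear_combination star u * u' * h - star u * u * mul_star_of_norm hu' - mul_star_of_norm hu
  rw [← star_inj] at key
  simp only [star_add, star_star, star_one, star_zero] at key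
  rcases three_sum hp hq key with ⟨h1, -⟩ | ⟨-, h1⟩
  · left
    linear_combination u' * v * h1 - u * star v * v' * v * mul_star_of_norm hu'
      - u * v' * mul_star_of_norm hv
  · right
    linear_combination u' * w * h1 - u * star w * w' * w * mul_star_of_norm hu'
      - u * w' * mul_star_of_norm hw

/-- Without singular `2 × 2` submatrices, two rows sharing three columns lead to a block of order
five or six. -/
theorem IsWeighing.contains_W5_or_W6 [Fintype ι] [Fintype κ] (h : IsWeighing W)
    (hns : ¬HasSingular W) (hA : ¬AtMostTwo W) : Contains W W5 ∨ Contains W W6 := by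
  simp only [AtMostTwo, not_forall] at hA
  obtain ⟨r1, r2, x, y, z, x1, y1, z1, x2, y2, z2, hxy, hxz, hyz, hr⟩ := hA
  obtain ⟨t, s1⟩ := h.supp_three r1 hxy hxz hyz x1 y1 z1
  obtain ⟨s, s2⟩ := h.supp_three r2 hxy hxz hyz x2 y2 z2
  have ts : t ≠ s := by
    rintro rfl
    exact hns (h.hasSingular_of_supp hr s1 s2)
  have o := h.orth hr s1
  obtain ⟨⟨-, -, n7, -, n8, n9⟩, -⟩ := id s1
  have t2 : W r2 t = 0 := s2.eq_zero n7.symm n8.symm n9.symm ts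
  rw [t2, star_zero, mul_zero, add_zero] at o
  rcases three_sum_ratio (h.norm x1) (h.norm y1) (h.norm z1) (h.norm x2) (h.norm y2) (h.norm z2) o
    with h1 | h1
  · exact h.contains_of_shareThree hns ⟨hr, s1, s2, ts, h1⟩
  · exact h.contains_of_shareThree hns ⟨hr, s1.swap, s2.swap, ts, h1⟩

end

section

variable {ι κ : Type}

/-! ### Singular `2 × 2` submatrices: the blocks of the family `E` -/

/-- The equality case of the triangle inequality for `u + v = -2` in the unit disc. -/
theorem eq_neg_one_of_add {u v : ℂ} (hu : ‖u‖ ≤ 1) (hv : ‖v‖ ≤ 1) (h : 2 + u + v = 0) :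
    u = -1 ∧ v = -1 := by
  have P := parallelogram u v
  have h1 : u + v = -2 := by linear_combination h
  rw [h1] at P
  have hu2 := pow_le_pow_left₀ (norm_nonneg _) hu 2
  have hv2 := pow_le_pow_left₀ (norm_nonneg _) hv 2
  norm_num at P
  have h2 : ‖u - v‖ ^ 2 ≤ 0 := by linarith
  have h3 : u - v = 0 := by simpa using le_antisymm h2 (sq_nonneg _)
  exact ⟨by linear_combination (h1 + h3) / 2, by linear_combination (h1 - h3) / 2⟩

theorem IsWeighing.norm_le [Fintype ι] [Fintype κ] {W : Matrix ι κ ℂ} (h : IsWeighing W) (i : ι)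
    (j : κ) : ‖W i j‖ ≤ 1 := by
  rcases h.entry i j with e | e <;> simp [e]

/-- Two rows which agree in two positions are opposite in all other positions. -/
theorem IsWeighing.opposite [Fintype ι] [Fintype κ] {W : Matrix ι κ ℂ} (h : IsWeighing W)
    {i i' : ι} {x y : κ} (hi : i ≠ i') (hxy : x ≠ y) (hx : W i x ≠ 0) (hy : W i y ≠ 0)
    (ex : W i' x = W i x) (ey : W i' y = W i y) :
    ∃ d d', d ≠ d' ∧ d ≠ x ∧ d ≠ y ∧ d' ≠ x ∧ d' ≠ y ∧ W i d ≠ 0 ∧ W i d' ≠ 0 ∧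
      ∀ t, t ≠ x → t ≠ y → W i' t = -W i t := by
  obtain ⟨d, d', hs⟩ := h.supp_two i hxy hx hy
  have ex' : W i' x ≠ 0 := by rwa [ex]
  have ey' : W i' y ≠ 0 := by rwa [ey]
  have o := h.orth hi hs
  rw [ex, ey, mul_star_of_norm (h.norm hx), mul_star_of_norm (h.norm hy)] at o
  have le : ∀ j, ‖W i j * star (W i' j)‖ ≤ 1 := fun j => by
    rw [norm_mul, norm_star]
    exact mul_le_one₀ (h.norm_le i j) (norm_nonneg _) (h.norm_le i' j)
  obtain ⟨h1, h2⟩ := eq_neg_one_of_add (le d) (le d') (by linear_combination o)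
  have key : ∀ t, W i t * star (W i' t) = -1 → W i' t = -W i t := by
    intro t ht
    have h0 : W i' t ≠ 0 := by
      intro h0
      simp [h0] at ht
    linear_combination W i' t * ht - W i t * mul_star_of_norm (h.norm h0)
  obtain ⟨-, -, n3, n4⟩ := hs.ne_zero
  have k1 := key d h1
  have k2 := key d' h2
  obtain ⟨⟨-, a2, a3, a4, a5, a6⟩, hs⟩ := hs
  refine ⟨d, d', a6, a2.symm, a4.symm, a3.symm, a5.symm, n3, n4, fun t tx ty => ?_⟩
  by_cases ht : W i t = 0
  · rw [ht, neg_zero]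
    by_contra h0
    have s4 := h.supp_four i' ⟨hxy, a2, a3, a4, a5, a6⟩ ex' ey' (by rw [k1]; simpa)
      (by rw [k2]; simpa)
    exact (hs t).2 ((s4.2 t).1 h0) ht
  · rcases (hs t).1 ht with e | e | rfl | rfl
    exacts [absurd e tx, absurd e ty, k1, k2]

/-- Two rows, each with opposite entries in the columns `x` and `y`, can be scaled to have the
entries `1` and `-1` there. -/
theorem IsWeighing.exists_scaled_pair [Fintype ι] [Fintype κ] {W : Matrix ι κ ℂ}
    (h : IsWeighing W) {s s' : ι} {x y : κ} (hx : W s x ≠ 0) (hx' : W s' x ≠ 0)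
    (hy : W s y = -W s x) (hy' : W s' y = -W s' x) :
    ∃ W', Scaled W W' ∧ W' s x = 1 ∧ W' s y = -1 ∧ W' s' x = 1 ∧ W' s' y = -1 ∧
      ∀ i, i ≠ s → i ≠ s' → ∀ j, W' i j = W i j := by
  classical
  let ρ : ι → ℂ := fun i => if i = s ∨ i = s' then star (W i x) else 1
  refine ⟨fun i j => ρ i * W i j, ⟨ρ, 1, fun i => ?_, by simp, by simp⟩, ?_, ?_, ?_, ?_, ?_⟩
  · by_cases hi : i = s ∨ i = s'
    · rcases hi with rfl | rfl
      · simp [ρ, h.norm hx]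
      · simp [ρ, h.norm hx']
    · simp [ρ, hi]
  · simpa [ρ] using star_mul_of_norm (h.norm hx)
  · simpa [ρ, hy] using star_mul_of_norm (h.norm hx)
  · simpa [ρ] using star_mul_of_norm (h.norm hx')
  · simpa [ρ, hy'] using star_mul_of_norm (h.norm hx')
  · intro i h1 h2 j
    simp [ρ, h1, h2]

/-- A partial copy of a block `E m x`: the rows `r p, r' p` form the row pair `p`, the columns
`c q, c' q` form the column pair `q` (for `p, q < k`), and all cells except the last one on the
diagonal are as in `E`. -/
structure Chain (W : Matrix ι κ ℂ) (k : ℕ) (r r' : ℕ → ι) (c c' : ℕ → κ) : Prop where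
  r_inj : ∀ p < k, ∀ q < k, (r p = r q → p = q) ∧ (r' p = r' q → p = q) ∧ r p ≠ r' q
  c_inj : ∀ p < k, ∀ q < k, (c p = c q → p = q) ∧ (c' p = c' q → p = q) ∧ c p ≠ c' q
  base : W (r 0) (c 0) = 1 ∧ W (r 0) (c' 0) = 1 ∧ W (r' 0) (c 0) = 1 ∧ W (r' 0) (c' 0) = 1
  up : ∀ p, p + 1 < k → W (r p) (c (p + 1)) = 1 ∧ W (r p) (c' (p + 1)) = 1 ∧
    W (r' p) (c (p + 1)) = -1 ∧ W (r' p) (c' (p + 1)) = -1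
  down : ∀ p, p + 1 < k → W (r (p + 1)) (c p) = 1 ∧ W (r' (p + 1)) (c p) = 1 ∧
    W (r (p + 1)) (c' p) = -1 ∧ W (r' (p + 1)) (c' p) = -1

namespace Chain

variable {W : Matrix ι κ ℂ} {k : ℕ} {r r' : ℕ → ι} {c c' : ℕ → κ}

theorem transpose (h : Chain W k r r' c c') : Chain Wᵀ k c c' r r' :=
  ⟨h.c_inj, h.r_inj, ⟨h.base.1, h.base.2.2.1, h.base.2.1, h.base.2.2.2⟩, h.down, h.up⟩

/-- A chain can be prolonged by two rows and two columns. -/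
theorem extend [Fintype ι] [Fintype κ] (hC : Chain W (k + 1) r r' c c') (h : IsWeighing W)
    {d d' : κ} {s s' : ι} (hd : d ≠ d') (hs : s ≠ s')
    (hdc : ∀ q ≤ k, d ≠ c q ∧ d ≠ c' q ∧ d' ≠ c q ∧ d' ≠ c' q)
    (hsr : ∀ q ≤ k, s ≠ r q ∧ s ≠ r' q ∧ s' ≠ r q ∧ s' ≠ r' q)
    (d1 : W (r k) d ≠ 0) (d2 : W (r k) d' ≠ 0) (d3 : W (r' k) d = -W (r k) d)
    (d4 : W (r' k) d' = -W (r k) d')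
    (s1 : W s (c k) ≠ 0) (s2 : W s' (c k) ≠ 0) (s3 : W s (c' k) = -W s (c k))
    (s4 : W s' (c' k) = -W s' (c k)) :
    ∃ W' r₁ r₁' c₁ c₁', Scaled W W' ∧ IsWeighing W' ∧ Chain W' (k + 2) r₁ r₁' c₁ c₁' := by
  obtain ⟨W1, sc1, a1, a2, a3, a4, a5⟩ := h.transpose.exists_scaled_pair (s := d) (s' := d')
    (x := r k) (y := r' k) d1 d2 d3 d4
  have hW1 := sc1.isWeighing h.transpose
  have b5 : ∀ j, j ≠ d → j ≠ d' → ∀ i, W1 j i = W i j := a5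
  have ck : W1 (c k) = Wᵀ (c k) := funext fun i =>
    b5 _ (hdc k le_rfl).1.symm (hdc k le_rfl).2.2.1.symm i
  have ck' : W1 (c' k) = Wᵀ (c' k) := funext fun i =>
    b5 _ (hdc k le_rfl).2.1.symm (hdc k le_rfl).2.2.2.symm i
  obtain ⟨W2, sc2, e1, e2, e3, e4, e5⟩ := hW1.transpose.exists_scaled_pair (s := s) (s' := s')
    (x := c k) (y := c' k) (by rw [transpose_apply, ck]; exact s1)
    (by rw [transpose_apply, ck]; exact s2)
    (by rw [transpose_apply, transpose_apply, ck, ck']; exact s3)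
    (by rw [transpose_apply, transpose_apply, ck, ck']; exact s4)
  have e6 : ∀ i, i ≠ s → i ≠ s' → ∀ j, W2 i j = W1 j i := e5
  have old : ∀ p ≤ k, ∀ q ≤ k, W2 (r p) (c q) = W (r p) (c q) ∧ W2 (r p) (c' q) = W (r p) (c' q) ∧
      W2 (r' p) (c q) = W (r' p) (c q) ∧ W2 (r' p) (c' q) = W (r' p) (c' q) := by
    intro p hp q hq
    obtain ⟨f1, f2, f3, f4⟩ := hdc q hq
    obtain ⟨g1, g2, g3, g4⟩ := hsr p hp
    rw [e6 _ g1.symm g3.symm, e6 _ g1.symm g3.symm, e6 _ g2.symm g4.symm, e6 _ g2.symm g4.symm,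
      b5 _ f1.symm f3.symm, b5 _ f1.symm f3.symm, b5 _ f2.symm f4.symm, b5 _ f2.symm f4.symm]
    simp
  obtain ⟨g1, g2, g3, g4⟩ := hsr k le_rfl
  refine ⟨W2, Function.update r (k + 1) s, Function.update r' (k + 1) s',
    Function.update c (k + 1) d, Function.update c' (k + 1) d',
    sc1.transpose.trans sc2, sc2.isWeighing hW1.transpose, ?_, ?_, ?_, ?_, ?_⟩
  · intro p hp q hq
    have := fun (hp : p < k + 1) (hq : q < k + 1) => hC.r_inj p hp q hq
    rcases (Nat.lt_succ_iff_lt_or_eq.1 hp) with hp | rfl <;>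
      rcases (Nat.lt_succ_iff_lt_or_eq.1 hq) with hq | rfl
    · simpa [Function.update_of_ne hp.ne, Function.update_of_ne hq.ne] using this hp hq
    · have := hsr p (by omega)
      simp [Function.update_of_ne hp.ne]
      tauto
    · have := hsr q (by omega)
      simp [Function.update_of_ne hq.ne]
      tauto
    · simpa using hs
  · intro p hp q hq
    have := fun (hp : p < k + 1) (hq : q < k + 1) => hC.c_inj p hp q hq
    rcases (Nat.lt_succ_iff_lt_or_eq.1 hp) with hp | rfl <;>
      rcases (Nat.lt_succ_iff_lt_or_eq.1 hq) with hq | rfl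
    · simpa [Function.update_of_ne hp.ne, Function.update_of_ne hq.ne] using this hp hq
    · have := hdc p (by omega)
      simp [Function.update_of_ne hp.ne]
      tauto
    · have := hdc q (by omega)
      simp [Function.update_of_ne hq.ne]
      tauto
    · simpa using hd
  · obtain ⟨o1, o2, o3, o4⟩ := old 0 (by omega) 0 (by omega)
    simpa [o1, o2, o3, o4] using hC.base
  · intro p hp
    rcases (Nat.lt_succ_iff_lt_or_eq.1 hp) with hp | hp
    · obtain ⟨o1, o2, o3, o4⟩ := old p (by omega) (p + 1) (by omega)
      have hp1 : p ≠ k + 1 := by omega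
      have hp2 : p + 1 ≠ k + 1 := by omega
      simpa only [Function.update_of_ne hp1, Function.update_of_ne hp2, o1, o2, o3, o4]
        using hC.up p hp
    · obtain rfl : p = k := by omega
      have hp1 : p ≠ p + 1 := by omega
      simp only [Function.update_of_ne hp1, Function.update_self]
      rw [e6 _ g1.symm g3.symm, e6 _ g1.symm g3.symm, e6 _ g2.symm g4.symm, e6 _ g2.symm g4.symm]
      exact ⟨a1, a3, a2, a4⟩
  · intro p hp
    rcases (Nat.lt_succ_iff_lt_or_eq.1 hp) with hp | hp
    · obtain ⟨o1, o2, o3, o4⟩ := old (p + 1) (by omega) p (by omega)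
      have hp1 : p ≠ k + 1 := by omega
      have hp2 : p + 1 ≠ k + 1 := by omega
      simpa only [Function.update_of_ne hp1, Function.update_of_ne hp2, o1, o2, o3, o4]
        using hC.down p hp
    · obtain rfl : p = k := by omega
      have hp1 : p ≠ p + 1 := by omega
      simp only [Function.update_of_ne hp1, Function.update_self]
      exact ⟨e1, e3, e2, e4⟩

/-- The lines of a chain other than the last pairs have their whole support inside the chain. -/
theorem supp [Fintype ι] [Fintype κ] (hC : Chain W k r r' c c') (h : IsWeighing W) {p : ℕ}
    (hp : p + 1 < k) : Supp (W (r p)) (c (p - 1)) (c' (p - 1)) (c (p + 1)) (c' (p + 1)) ∧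
      Supp (W (r' p)) (c (p - 1)) (c' (p - 1)) (c (p + 1)) (c' (p + 1)) := by
  have hd : c (p - 1) ≠ c' (p - 1) ∧ c (p - 1) ≠ c (p + 1) ∧ c (p - 1) ≠ c' (p + 1) ∧
      c' (p - 1) ≠ c (p + 1) ∧ c' (p - 1) ≠ c' (p + 1) ∧ c (p + 1) ≠ c' (p + 1) := by
    have i1 := hC.c_inj (p - 1) (by omega) (p - 1) (by omega)
    have i2 := hC.c_inj (p - 1) (by omega) (p + 1) (by omega)
    have i3 := hC.c_inj (p + 1) (by omega) (p - 1) (by omega)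
    have i4 := hC.c_inj (p + 1) (by omega) (p + 1) (by omega)
    refine ⟨i1.2.2, fun e => ?_, i2.2.2, i3.2.2.symm, fun e => ?_, i4.2.2⟩
    · have := i2.1 e; omega
    · have := i2.2.1 e; omega
  obtain ⟨u1, u2, u3, u4⟩ := hC.up p hp
  have low : W (r p) (c (p - 1)) ≠ 0 ∧ W (r p) (c' (p - 1)) ≠ 0 ∧ W (r' p) (c (p - 1)) ≠ 0 ∧
      W (r' p) (c' (p - 1)) ≠ 0 := by
    rcases p with _ | p
    · obtain ⟨b1, b2, b3, b4⟩ := hC.base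
      simp [b1, b2, b3, b4]
    · obtain ⟨b1, b2, b3, b4⟩ := hC.down p (by omega)
      simp [b1, b2, b3, b4]
  obtain ⟨l1, l2, l3, l4⟩ := low
  exact ⟨h.supp_four _ hd l1 l2 (by simp [u1]) (by simp [u2]),
    h.supp_four _ hd l3 l4 (by simp [u3]) (by simp [u4])⟩

/-- A column outside of the pair `k` which meets the last row, but misses the last cell on the
diagonal, is new. -/
theorem col_new [Fintype ι] [Fintype κ] (hC : Chain W (k + 2) r r' c c') (h : IsWeighing W)
    (z : W (r (k + 1)) (c (k + 1)) = 0) (z' : W (r (k + 1)) (c' (k + 1)) = 0) {d : κ}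
    (hd : W (r (k + 1)) d ≠ 0) (n : d ≠ c k) (n' : d ≠ c' k) :
    ∀ q ≤ k + 1, d ≠ c q ∧ d ≠ c' q := by
  intro q hq
  by_cases hq1 : q = k + 1
  · subst hq1
    exact ⟨by rintro rfl; exact hd z, by rintro rfl; exact hd z'⟩
  by_cases hq2 : q = k
  · subst hq2
    exact ⟨n, n'⟩
  obtain ⟨t1, t2⟩ := hC.transpose.supp h.transpose (p := q) (by omega)
  have i1 := hC.r_inj (k + 1) (by omega) (q - 1) (by omega)
  have i2 := hC.r_inj (k + 1) (by omega) (q + 1) (by omega)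
  have key : ¬(r (k + 1) = r (q - 1) ∨ r (k + 1) = r' (q - 1) ∨ r (k + 1) = r (q + 1) ∨
      r (k + 1) = r' (q + 1)) := by
    rintro (e | e | e | e)
    · have := i1.1 e; omega
    · exact i1.2.2 e
    · have := i2.1 e; omega
    · exact i2.2.2 e
  exact ⟨by rintro rfl; exact key ((t1.2 _).1 hd), by rintro rfl; exact key ((t2.2 _).1 hd)⟩

/-- A chain whose last cell on the diagonal is nonzero is a block of the family `E`. -/
theorem contains_E (hC : Chain W (k + 2) r r' c c') {x : Circle}
    (x1 : W (r (k + 1)) (c (k + 1)) = x) (x2 : W (r (k + 1)) (c' (k + 1)) = -x)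
    (x3 : W (r' (k + 1)) (c (k + 1)) = -x) (x4 : W (r' (k + 1)) (c' (k + 1)) = x) :
    Contains W (E (k + 2) x) := by
  have inj : ∀ {α : Type} {f f' : ℕ → α},
      (∀ p < k + 2, ∀ q < k + 2, (f p = f q → p = q) ∧ (f' p = f' q → p = q) ∧ f p ≠ f' q) →
      Function.Injective fun i : Fin (2 * (k + 2)) =>
        if i.val % 2 = 0 then f (i.val / 2) else f' (i.val / 2) := by
    intro α f f' hf i j hij
    have h1 := hf (i.val / 2) (by omega) (j.val / 2) (by omega)
    have h2 := hf (j.val / 2) (by omega) (i.val / 2) (by omega)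
    ext
    dsimp only at hij
    split_ifs at hij with hi hj hj
    · have := h1.1 hij; omega
    · exact absurd hij h1.2.2
    · exact absurd hij.symm h2.2.2
    · have := h1.2.1 hij; omega
  refine Contains.of_eq _ _ (inj hC.r_inj) (inj hC.c_inj) fun i j hE => ?_
  have par : ∀ n : ℕ, (n % 2 = 0 → (-1 : ℂ) ^ n = 1) ∧ (¬n % 2 = 0 → (-1 : ℂ) ^ n = -1) :=
    fun n => ⟨fun hn => Even.neg_one_pow (Nat.even_iff.2 hn),
      fun hn => Odd.neg_one_pow (Nat.odd_iff.2 (by omega))⟩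
  have hi := i.isLt
  have hj := j.isLt
  simp only [E, of_apply] at hE ⊢
  by_cases g1 : i.val / 2 = 0 ∧ j.val / 2 = 0
  · obtain ⟨b1, b2, b3, b4⟩ := hC.base
    rw [if_pos g1, g1.1, g1.2]
    split_ifs <;> assumption
  by_cases g2 : j.val / 2 = i.val / 2 + 1
  · obtain ⟨b1, b2, b3, b4⟩ := hC.up (i.val / 2) (by omega)
    rw [if_neg g1, if_pos g2, g2]
    split_ifs with hi <;> simp only [(par i).1, (par i).2, hi, not_false_eq_true] <;> assumption
  by_cases g3 : i.val / 2 = j.val / 2 + 1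
  · obtain ⟨b1, b2, b3, b4⟩ := hC.down (j.val / 2) (by omega)
    rw [if_neg g1, if_neg g2, if_pos g3, g3]
    split_ifs with hi hj hj <;>
      simp only [(par j).1, (par j).2, hj, not_false_eq_true] <;> assumption
  by_cases g4 : i.val / 2 = j.val / 2 ∧ i.val / 2 + 1 = k + 2
  · have g5 : i.val / 2 = k + 1 := by omega
    have g6 : j.val / 2 = k + 1 := by omega
    rw [if_neg g1, if_neg g2, if_neg g3, if_pos g4, g5, g6, pow_add]
    split_ifs with hi hj hj <;>
      simp only [(par i).1, (par i).2, (par j).1, (par j).2, hi, hj, not_false_eq_true] <;>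
      simp [x1, x2, x3, x4]
  · rw [if_neg g1, if_neg g2, if_neg g3, if_neg g4] at hE
    exact absurd rfl hE

/-- A chain of length at least two closes up or can be prolonged. -/
theorem closes_or_extends [Fintype ι] [Fintype κ] (hC : Chain W (k + 2) r r' c c')
    (h : IsWeighing W) : (∃ x, Contains W (E (k + 2) x)) ∨
      ∃ W' r₁ r₁' c₁ c₁', Scaled W W' ∧ IsWeighing W' ∧ Chain W' (k + 3) r₁ r₁' c₁ c₁' := by
  have i1 := hC.r_inj (k + 1) (by omega) (k + 1) (by omega)
  have i2 := hC.r_inj k (by omega) k (by omega)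
  have i3 := hC.r_inj (k + 1) (by omega) k (by omega)
  have i4 := hC.r_inj k (by omega) (k + 1) (by omega)
  have j1 := hC.c_inj (k + 1) (by omega) (k + 1) (by omega)
  have j2 := hC.c_inj k (by omega) k (by omega)
  have j3 := hC.c_inj (k + 1) (by omega) k (by omega)
  have j4 := hC.c_inj k (by omega) (k + 1) (by omega)
  have i5 : r (k + 1) ≠ r k := fun e => by have := i3.1 e; omega
  have j5 : c (k + 1) ≠ c k := fun e => by have := j3.1 e; omega
  have i6 : r' (k + 1) ≠ r' k := fun e => by have := i3.2.1 e; omega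
  have j6 : c' (k + 1) ≠ c' k := fun e => by have := j3.2.1 e; omega
  obtain ⟨u1, u2, u3, u4⟩ := hC.up k (by omega)
  obtain ⟨v1, v2, v3, v4⟩ := hC.down k (by omega)
  obtain ⟨d, d', dd, dx, dy, dx', dy', d1, d2, d3⟩ := h.opposite i1.2.2 j2.2.2
    (by simp [v1]) (by simp [v3]) (v2.trans v1.symm) (v4.trans v3.symm)
  obtain ⟨s, s', ss, sx, sy, sx', sy', s1, s2, s3⟩ := h.transpose.opposite j1.2.2 i2.2.2
    (show W (r k) (c (k + 1)) ≠ 0 by simp [u1]) (show W (r' k) (c (k + 1)) ≠ 0 by simp [u3])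
    (u2.trans u1.symm) (u4.trans u3.symm)
  replace s3 : ∀ t, t ≠ r k → t ≠ r' k → W t (c' (k + 1)) = -W t (c (k + 1)) := s3
  -- the last cell on the diagonal has the form `(x -x; -x x)`
  have l1 := s3 (r (k + 1)) i5 i3.2.2
  have l2 := d3 (c (k + 1)) j5 j3.2.2
  have l3 := s3 (r' (k + 1)) i4.2.2.symm i6
  rw [l2, neg_neg] at l3
  by_cases hx : W (r (k + 1)) (c (k + 1)) = 0
  · right
    have hx1 : W (r (k + 1)) (c' (k + 1)) = 0 := by rw [l1, hx, neg_zero]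
    have hx2 : W (r' (k + 1)) (c (k + 1)) = 0 := by rw [l2, hx, neg_zero]
    have n1 := hC.col_new h hx hx1 d1 dx dy
    have n2 := hC.col_new h hx hx1 d2 dx' dy'
    have n3 := hC.transpose.col_new h.transpose hx hx2 s1 sx sy
    have n4 := hC.transpose.col_new h.transpose hx hx2 s2 sx' sy'
    exact hC.extend h dd ss (fun q hq => ⟨(n1 q hq).1, (n1 q hq).2, (n2 q hq).1, (n2 q hq).2⟩)
      (fun q hq => ⟨(n3 q hq).1, (n3 q hq).2, (n4 q hq).1, (n4 q hq).2⟩) d1 d2 (d3 d dx dy)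
      (d3 d' dx' dy') s1 s2 (s3 s sx sy) (s3 s' sx' sy')
  · left
    let x : Circle := ⟨W (r (k + 1)) (c (k + 1)), by simp [Submonoid.unitSphere, h.norm hx]⟩
    exact ⟨x, hC.contains_E (x := x) rfl l1 l2 l3⟩

theorem length_le [Fintype ι] (hC : Chain W k r r' c c') : k ≤ Fintype.card ι := by
  have : Function.Injective fun p : Fin k => r p := fun p q hpq =>
    Fin.ext ((hC.r_inj p p.isLt q q.isLt).1 hpq)
  simpa using Fintype.card_le_of_injective _ this

/-- A chain can be prolonged at most `n` times, so it leads to a block of the family `E`. -/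
theorem exists_contains_E [Fintype ι] [Fintype κ] (n : ℕ) : ∀ {W : Matrix ι κ ℂ} {k : ℕ}
    {r r' : ℕ → ι} {c c' : ℕ → κ}, IsWeighing W → Chain W (k + 2) r r' c c' →
    Fintype.card ι ≤ k + n → ∃ m x, 2 ≤ m ∧ Contains W (E m x) := by
  induction n with
  | zero =>
    intro W k r r' c c' h hC hn
    have := hC.length_le
    omega
  | succ n ih =>
    intro W k r r' c c' h hC hn
    rcases hC.closes_or_extends h with ⟨x, hx⟩ | ⟨W', r₁, r₁', c₁, c₁', sc, hW, hC'⟩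
    · exact ⟨k + 2, x, by omega, hx⟩
    · obtain ⟨m, x, hm, hx⟩ := ih (k := k + 1) hW hC' (by omega)
      exact ⟨m, x, hm, hx.of_scaled sc⟩

end Chain

/-- A singular `2 × 2` submatrix without zeros lies in a block of the family `E`. -/
theorem IsWeighing.contains_E [Fintype ι] [Fintype κ] {W : Matrix ι κ ℂ} (h : IsWeighing W)
    (hS : HasSingular W) : ∃ m x, 2 ≤ m ∧ Contains W (E m x) := by
  obtain ⟨i, i', j, j', hi, hj, h1, h2, h3, h4, h5⟩ := hS
  obtain ⟨W1, sc1, hW1, z1, a1, -⟩ := h.exists_scaled_cols fun _ => i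
  obtain ⟨W2, sc2, hW2, z2, a2, a3⟩ := hW1.exists_scaled_rows fun _ => j
  have sc := sc1.trans sc2
  have b1 : W2 i j = 1 := a2 i ((z1 _ _).2 h1)
  have b2 : W2 i j' = 1 := by rw [a3 i (Or.inr (a1 j h1)), a1 j' h2]
  have b3 : W2 i' j = 1 := a2 i' ((z1 _ _).2 h3)
  have b4 : W2 i' j' = 1 := by
    have := (sc.ratio (α := 1) (i := i) (i' := i') (j := j) (j' := j')).2 (by rw [h5, one_mul])
    simpa [b1, b2, b3] using this
  obtain ⟨d, d', dd, dx, dy, dx', dy', d1, d2, d3⟩ := hW2.opposite hi hj (by simp [b1])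
    (by simp [b2]) (b3.trans b1.symm) (b4.trans b2.symm)
  obtain ⟨s, s', ss, sx, sy, sx', sy', s1, s2, s3⟩ := hW2.transpose.opposite hj hi
    (show W2 i j ≠ 0 by simp [b1]) (show W2 i' j ≠ 0 by simp [b3]) (b2.trans b1.symm)
    (b4.trans b3.symm)
  have hC : Chain W2 1 (fun _ => i) (fun _ => i') (fun _ => j) (fun _ => j') :=
    ⟨fun p hp q hq => ⟨fun _ => by omega, fun _ => by omega, hi⟩,
      fun p hp q hq => ⟨fun _ => by omega, fun _ => by omega, hj⟩, ⟨b1, b2, b3, b4⟩,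
      fun p hp => by omega, fun p hp => by omega⟩
  obtain ⟨W3, r, r', c, c', sc3, hW3, hC3⟩ := hC.extend hW2 dd ss (fun _ _ => ⟨dx, dy, dx', dy'⟩)
    (fun _ _ => ⟨sx, sy, sx', sy'⟩) d1 d2 (d3 d dx dy) (d3 d' dx' dy') s1 s2 (s3 s sx sy)
    (s3 s' sx' sy')
  obtain ⟨m, x, hm, hx⟩ := Chain.exists_contains_E (Fintype.card ι) hW3 hC3 (by omega)
  exact ⟨m, x, hm, hx.of_scaled (sc.trans sc3)⟩

theorem W5_transpose : W5ᵀ = W5 := by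
  ext i j; fin_cases i <;> fin_cases j <;> rfl

theorem W6_transpose : W6ᵀ = W6 := by
  ext i j; fin_cases i <;> fin_cases j <;> rfl

/-- Every unit weighing matrix of weight four and positive order contains a block. -/
theorem IsWeighing.contains_block [Fintype ι] [Fintype κ] [Nonempty ι] {W : Matrix ι κ ℂ}
    (h : IsWeighing W) : ∃ b : Block, Contains W b.matrix := by
  by_cases hS : HasSingular W
  · obtain ⟨m, x, hm, hx⟩ := h.contains_E hS
    exact ⟨.e m hm x, hx⟩
  by_cases hr : AtMostTwo W
  · by_cases hc : AtMostTwo Wᵀ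
    · rcases h.containsPattern hr hc with hP | hP
      · exact ⟨.w7, h.contains_W7 hP⟩
      · exact ⟨.w8, h.contains_W8 hP⟩
    · rcases h.transpose.contains_W5_or_W6 (fun hS' => hS hS'.of_transpose) hc with hW | hW
      · exact ⟨.w5, hW.of_transpose W5_transpose⟩
      · exact ⟨.w6, hW.of_transpose W6_transpose⟩
  · rcases h.contains_W5_or_W6 hS hr with hW | hW
    · exact ⟨.w5, hW⟩
    · exact ⟨.w6, hW⟩

end

section

/-! ### The blocks are unit weighing matrices -/

theorem isUW_W5 : IsUW 4 W5 := by
  have h1 := a_add_a'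
  have h2 := a_mul_a'
  have c1 : (starRingEnd ℂ) a = a' := rfl
  have c2 : (starRingEnd ℂ) a' = a := star_a'
  constructor
  · intro i j
    fin_cases i <;> fin_cases j <;> simp [W5, norm_a, norm_a']
  · ext i j
    rw [mul_apply]
    fin_cases i <;> fin_cases j <;>
      simp [W5, Fin.sum_univ_succ, c1, c2] <;>
      grind

theorem isUW_W6 : IsUW 4 W6 := by
  have h1 := a_add_a'
  have h2 := a_mul_a'
  have c1 : (starRingEnd ℂ) a = a' := rfl
  have c2 : (starRingEnd ℂ) a' = a := star_a'
  constructor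
  · intro i j
    fin_cases i <;> fin_cases j <;> simp [W6, norm_a, norm_a']
  · ext i j
    rw [mul_apply]
    fin_cases i <;> fin_cases j <;>
      simp [W6, Fin.sum_univ_succ, c1, c2] <;>
      grind

theorem isUW_W7 : IsUW 4 W7 := by
  constructor
  · intro i j
    fin_cases i <;> fin_cases j <;> simp [W7]
  · ext i j
    rw [mul_apply]
    fin_cases i <;> fin_cases j <;> simp [W7, Fin.sum_univ_succ] <;> norm_num

theorem isUW_W8 : IsUW 4 W8 := by
  constructor
  · intro i j
    fin_cases i <;> fin_cases j <;> simp [W8]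
  · ext i j
    rw [mul_apply]
    fin_cases i <;> fin_cases j <;> simp [W8, Fin.sum_univ_succ] <;> norm_num

end

section

variable {ι κ ι' κ' ι'' κ'' : Type}

/-! ### Splitting off a block -/

/-- Equality up to relabelling and scaling of the rows and of the columns. -/
def Similar (W : Matrix ι κ ℂ) (W' : Matrix ι' κ' ℂ) : Prop :=
  ∃ (e : ι' ≃ ι) (f : κ' ≃ κ) (ρ : ι' → ℂ) (γ : κ' → ℂ), (∀ i, ‖ρ i‖ = 1) ∧ (∀ j, ‖γ j‖ = 1) ∧
    ∀ i j, W' i j = ρ i * γ j * W (e i) (f j)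

theorem Similar.trans {W : Matrix ι κ ℂ} {W' : Matrix ι' κ' ℂ} {W'' : Matrix ι'' κ'' ℂ}
    (h : Similar W W') (h' : Similar W' W'') : Similar W W'' := by
  obtain ⟨e, f, ρ, γ, hρ, hγ, h⟩ := h
  obtain ⟨e', f', ρ', γ', hρ', hγ', h'⟩ := h'
  refine ⟨e'.trans e, f'.trans f, fun i => ρ' i * ρ (e' i), fun j => γ' j * γ (f' j),
    by simp [*], by simp [*], fun i j => ?_⟩
  rw [h', h, Equiv.trans_apply, Equiv.trans_apply]; ring

theorem Similar.reindex (W : Matrix ι κ ℂ) (e : ι ≃ ι') (f : κ ≃ κ') :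
    Similar W (Matrix.reindex e f W) :=
  ⟨e.symm, f.symm, 1, 1, by simp, by simp, by simp⟩

theorem Similar.refl (W : Matrix ι κ ℂ) : Similar W W :=
  Similar.reindex W (Equiv.refl _) (Equiv.refl _)

theorem Similar.fromBlocks (B : Matrix ι'' κ'' ℂ) {W : Matrix ι κ ℂ} {W' : Matrix ι' κ' ℂ}
    (h : Similar W W') : Similar (fromBlocks B 0 0 W) (fromBlocks B 0 0 W') := by
  obtain ⟨e, f, ρ, γ, hρ, hγ, h⟩ := h
  refine ⟨(Equiv.refl _).sumCongr e, (Equiv.refl _).sumCongr f, Sum.elim 1 ρ, Sum.elim 1 γ,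
    ?_, ?_, ?_⟩
  · rintro (i | i) <;> simp [hρ]
  · rintro (j | j) <;> simp [hγ]
  · rintro (i | i) (j | j) <;> simp [h]

/-- Three diagonal blocks may be rearranged. -/
theorem Similar.fromBlocks_swap {α β α' β' : Type} (A : Matrix α β ℂ) (B : Matrix α' β' ℂ)
    (W : Matrix ι κ ℂ) : Similar (Matrix.fromBlocks A 0 0 (Matrix.fromBlocks B 0 0 W))
      (Matrix.fromBlocks B 0 0 (Matrix.fromBlocks A 0 0 W)) := by
  refine ⟨(Equiv.sumAssoc _ _ _).symm.trans
      (((Equiv.sumComm _ _).sumCongr (Equiv.refl _)).trans (Equiv.sumAssoc _ _ _)),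
    (Equiv.sumAssoc _ _ _).symm.trans
      (((Equiv.sumComm _ _).sumCongr (Equiv.refl _)).trans (Equiv.sumAssoc _ _ _)),
    1, 1, by simp, by simp, ?_⟩
  rintro (i | i | i) (j | j | j) <;> simp

theorem Similar.symm {W : Matrix ι κ ℂ} {W' : Matrix ι' κ' ℂ} (h : Similar W W') :
    Similar W' W := by
  obtain ⟨e, f, ρ, γ, hρ, hγ, h⟩ := h
  refine ⟨e.symm, f.symm, fun i => star (ρ (e.symm i)), fun j => star (γ (f.symm j)),
    by simp [*], by simp [*], fun i j => ?_⟩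
  rw [h, Equiv.apply_symm_apply, Equiv.apply_symm_apply]
  linear_combination -(star (ρ (e.symm i)) * ρ (e.symm i) * W i j) *
    star_mul_of_norm (hγ (f.symm j)) - W i j * star_mul_of_norm (hρ (e.symm i))

/-- If the nonzero entries of the rows in `R` are those of the columns in `C`, then the remaining
rows and columns form a weighing matrix. -/
theorem IsWeighing.submatrix_compl [Fintype ι] [Fintype κ] {W : Matrix ι κ ℂ} (h : IsWeighing W)
    (R : Set ι) (C : Set κ) [Fintype {i // i ∉ R}] [Fintype {j // j ∉ C}]
    (hRC : ∀ i j, W i j ≠ 0 → (i ∈ R ↔ j ∈ C)) :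
    IsWeighing (W.submatrix (Subtype.val : {i // i ∉ R} → ι) (Subtype.val : {j // j ∉ C} → κ)) := by
  classical
  refine ⟨fun i j => h.entry i j, fun i => ?_, fun j => ?_, fun i i' hi => ?_, fun j j' hj => ?_⟩
  · rw [← h.row_card i, ← Set.ncard_image_of_injective _ Subtype.val_injective]
    congr 1
    ext j
    constructor
    · rintro ⟨j, hj, rfl⟩
      exact hj
    · intro hj
      exact ⟨⟨j, fun hC => i.2 ((hRC _ _ hj).2 hC)⟩, hj, rfl⟩
  · rw [← h.col_card j, ← Set.ncard_image_of_injective _ Subtype.val_injective]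
    congr 1
    ext i
    constructor
    · rintro ⟨i, hi, rfl⟩
      exact hi
    · intro hi
      exact ⟨⟨i, fun hR => j.2 ((hRC _ _ hi).1 hR)⟩, hi, rfl⟩
  · have key := Fintype.sum_subtype_add_sum_subtype (fun j => j ∉ C) fun j => W i j * star (W i' j)
    have z : ∑ j : {j // ¬j ∉ C}, W i j * star (W i' j) = 0 := by
      refine Finset.sum_eq_zero fun j _ => ?_
      have : W i j = 0 := by
        by_contra h0
        exact i.2 ((hRC _ _ h0).2 (not_not.1 j.2))
      rw [this, zero_mul]
    rw [z, add_zero, h.row_orth i i' fun e => hi (Subtype.ext e)] at key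
    simp only [submatrix_apply]
    convert key
  · have key := Fintype.sum_subtype_add_sum_subtype (fun i => i ∉ R) fun i => W i j * star (W i j')
    have z : ∑ i : {i // ¬i ∉ R}, W i j * star (W i j') = 0 := by
      refine Finset.sum_eq_zero fun i _ => ?_
      have : W i j = 0 := by
        by_contra h0
        exact j.2 ((hRC _ _ h0).1 (not_not.1 i.2))
      rw [this, zero_mul]
    rw [z, add_zero, h.col_orth j j' fun e => hj (Subtype.ext e)] at key
    simp only [submatrix_apply]
    convert key

theorem exists_equiv_sum {α β : Type} {f : α → β} (hf : f.Injective) :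
    ∃ e : α ⊕ {b // b ∉ Set.range f} ≃ β, (∀ x, e (Sum.inl x) = f x) ∧ ∀ y, e (Sum.inr y) = y := by
  refine ⟨Equiv.ofBijective (Sum.elim f Subtype.val) ⟨?_, fun b => ?_⟩, fun x => rfl, fun y => rfl⟩
  · rintro (x | x) (y | y) h
    · rw [hf h]
    · exact absurd ⟨x, h⟩ y.2
    · exact absurd ⟨y, h.symm⟩ x.2
    · rw [Subtype.ext h]
  · by_cases hb : b ∈ Set.range f
    · obtain ⟨x, rfl⟩ := hb
      exact ⟨Sum.inl x, rfl⟩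
    · exact ⟨Sum.inr ⟨b, hb⟩, rfl⟩

/-- A row of a copy of `B` has no nonzero entries outside of the copy: `B` already accounts for all
four of them. -/
theorem eq_of_contains [Fintype ι] [Fintype κ] {k : ℕ} {W : Matrix ι κ ℂ} (h : IsWeighing W)
    {B : Matrix (Fin k) (Fin k) ℂ} (hB : IsWeighing B) {r : Fin k → ι} {c : Fin k → κ}
    (hc : c.Injective) (hW : ∀ i j, B i j ≠ 0 → W (r i) (c j) ≠ 0) (i : Fin k) {j : κ}
    (hj : W (r i) j ≠ 0) : ∃ j', B i j' ≠ 0 ∧ c j' = j := by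
  have hsub : c '' {j' | B i j' ≠ 0} ⊆ {j | W (r i) j ≠ 0} := by
    rintro _ ⟨j', hj', rfl⟩
    exact hW i j' hj'
  have := Set.eq_of_subset_of_ncard_le hsub (by
    rw [Set.ncard_image_of_injective _ hc, hB.row_card, h.row_card])
  rw [Set.ext_iff] at this
  exact (this j).2 hj

/-- A weighing matrix which contains a weighing matrix `B` is a direct sum of `B` and another
weighing matrix, up to relabelling and scaling. -/
theorem IsWeighing.exists_similar_fromBlocks [Fintype ι] [Fintype κ] {k : ℕ} {W : Matrix ι κ ℂ}
    (h : IsWeighing W) {B : Matrix (Fin k) (Fin k) ℂ} (hB : IsWeighing B) (hWB : Contains W B) :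
    ∃ (ι' κ' : Type) (_ : Fintype ι') (_ : Fintype κ') (W' : Matrix ι' κ' ℂ), IsWeighing W' ∧
      Similar W (Matrix.fromBlocks B 0 0 W') := by
  classical
  obtain ⟨r, c, ρ, γ, hr, hc, hρ, hγ, hW⟩ := hWB
  have hne : ∀ i j, B i j ≠ 0 → W (r i) (c j) ≠ 0 := fun i j hij => by
    rw [hW i j hij]
    simp [ne_zero_of_norm (hρ i), ne_zero_of_norm (hγ j), hij]
  have row : ∀ i j, W (r i) j ≠ 0 → ∃ j', B i j' ≠ 0 ∧ c j' = j :=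
    fun i j => eq_of_contains h hB hc hne i
  have col : ∀ j i, W i (c j) ≠ 0 → ∃ i', B i' j ≠ 0 ∧ r i' = i :=
    fun j i => eq_of_contains h.transpose hB.transpose hr (fun j i => hne i j) j
  refine ⟨{i // i ∉ Set.range r}, {j // j ∉ Set.range c}, inferInstance, inferInstance, _,
    h.submatrix_compl (Set.range r) (Set.range c) ?_, ?_⟩
  · intro i j hij
    constructor
    · rintro ⟨i, rfl⟩
      obtain ⟨j', -, rfl⟩ := row i j hij
      exact ⟨j', rfl⟩
    · rintro ⟨j, rfl⟩
      obtain ⟨i', -, rfl⟩ := col j i hij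
      exact ⟨i', rfl⟩
  · obtain ⟨e, e1, e2⟩ := exists_equiv_sum hr
    obtain ⟨f, f1, f2⟩ := exists_equiv_sum hc
    refine ⟨e, f, Sum.elim (fun i => star (ρ i)) 1, Sum.elim (fun j => star (γ j)) 1, ?_, ?_, ?_⟩
    · rintro (i | i) <;> simp [hρ]
    · rintro (j | j) <;> simp [hγ]
    · rintro (i | i) (j | j)
      · rw [e1, f1, fromBlocks_apply₁₁, Sum.elim_inl, Sum.elim_inl]
        by_cases hij : B i j = 0
        · have : W (r i) (c j) = 0 := by
            by_contra h0
            obtain ⟨j', hj', e⟩ := row i _ h0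
            rw [hc e] at hj'
            exact hj' hij
          rw [this, hij, mul_zero]
        · rw [hW i j hij]
          linear_combination -(star (γ j) * γ j * B i j) * star_mul_of_norm (hρ i)
            - B i j * star_mul_of_norm (hγ j)
      · have : W (r i) j = 0 := by
          by_contra h0
          obtain ⟨j', -, e⟩ := row i _ h0
          exact j.2 ⟨j', e⟩
        rw [e1, f2, this, mul_zero]; rfl
      · have : W i (c j) = 0 := by
          by_contra h0
          obtain ⟨i', -, e⟩ := col j _ h0
          exact i.2 ⟨i', e⟩
        rw [e2, f1, this, mul_zero]; rfl
      · simp [e2, f2]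

end

section

theorem sum_fin_two_mul {M : Type} [AddCommMonoid M] (m : ℕ) (f : ℕ → M) :
    ∑ j : Fin (2 * m), f j = ∑ q ∈ Finset.range m, (f (2 * q) + f (2 * q + 1)) := by
  rw [Fin.sum_univ_eq_sum_range]
  induction m with
  | zero => simp
  | succ m ih =>
    rw [Finset.sum_range_succ, ← ih, Nat.mul_succ, Finset.sum_range_succ, Finset.sum_range_succ,
      add_assoc]

theorem isUW_E {m : ℕ} (hm : 2 ≤ m) (x : Circle) : IsUW 4 (E m x) := by
  have hx : ‖(x : ℂ)‖ = 1 := Circle.norm_coe x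
  have xx := mul_star_of_norm hx
  constructor
  · intro i j
    simp only [E, of_apply]
    split_ifs <;> simp [hx]
  -- the entries as a function of natural numbers, so that the columns can be summed in pairs
  let F : ℕ → ℕ → ℂ := fun i j =>
    if i / 2 = 0 ∧ j / 2 = 0 then 1
    else if j / 2 = i / 2 + 1 then (-1) ^ i
    else if i / 2 = j / 2 + 1 then (-1) ^ j
    else if i / 2 = j / 2 ∧ i / 2 + 1 = m then (-1) ^ (i + j) * (x : ℂ)
    else 0
  have hq : ∀ q : ℕ, 2 * q / 2 = q ∧ (2 * q + 1) / 2 = q := fun q => by omega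
  have hs : ∀ q : ℕ, (-1 : ℂ) ^ (2 * q) = 1 := fun q => by rw [pow_mul]; simp
  ext i i'
  have hi := i.isLt
  have hi' := i'.isLt
  have e : (E m x * (E m x)ᴴ) i i' = ∑ q ∈ Finset.range m,
      (F i (2 * q) * star (F i' (2 * q)) + F i (2 * q + 1) * star (F i' (2 * q + 1))) := by
    rw [← sum_fin_two_mul m fun j => F i j * star (F i' j), mul_apply]
    rfl
  have sgn : ∀ n : ℕ, star ((-1 : ℂ) ^ n) = (-1) ^ n := fun n => by simp
  rw [e]
  by_cases hp : (i : ℕ) / 2 = i' / 2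
  · -- the row pair `p` meets the column pairs `p - 1` and `p + 1`, up to the ends
    have : ∀ q ∈ Finset.range m,
        F i (2 * q) * star (F i' (2 * q)) + F i (2 * q + 1) * star (F i' (2 * q + 1)) =
        (if q = i.val / 2 - 1 then 2 else 0) +
          (if q = min (i.val / 2 + 1) (m - 1) then 2 * (-1) ^ (i.val + i'.val) else 0) := by
      intro q hqm
      rw [Finset.mem_range] at hqm
      simp only [F, (hq q).1, (hq q).2, ← hp]
      split_ifs <;> first
        | omega
        | (simp only [star_one, star_zero, star_neg, star_mul', sgn, pow_add _ (_ : ℕ) (_ : ℕ), hs, pow_one]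
           first
           | ring1
           | linear_combination 2 * (-1) ^ i.val * (-1) ^ i'.val * xx)
    rw [Finset.sum_congr rfl this, Finset.sum_add_distrib, Finset.sum_ite_eq', Finset.sum_ite_eq',
      if_pos (Finset.mem_range.2 (by omega)), if_pos (Finset.mem_range.2 (by omega))]
    by_cases hii : i = i'
    · subst hii
      rw [← two_mul, hs]
      simp
      norm_num
    · have hne : (i : ℕ) ≠ i' := fun e => hii (Fin.ext e)
      have odd : Odd (i.val + i'.val) := Nat.odd_iff.2 (by omega)
      rw [odd.neg_one_pow, Matrix.smul_apply, one_apply_ne hii]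
      simp
  · have hne : i ≠ i' := by rintro rfl; exact hp rfl
    rw [Matrix.smul_apply, one_apply_ne hne, smul_zero]
    -- two row pairs meeting the column pair `q` have equal entries there, respectively opposite ones
    refine Finset.sum_eq_zero fun q hqm => ?_
    rw [Finset.mem_range] at hqm
    simp only [F, (hq q).1, (hq q).2]
    split_ifs <;> first | omega | simp [pow_add, hs]

theorem Block.isUW : ∀ b : Block, IsUW 4 b.matrix
  | .w5 => isUW_W5
  | .w6 => isUW_W6
  | .w7 => isUW_W7
  | .w8 => isUW_W8
  | .e _ hm x => isUW_E hm x

theorem isUW_reindex_fromBlocks {m n k : ℕ} (e : Fin m ⊕ Fin n ≃ Fin k)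
    {A : Matrix (Fin m) (Fin m) ℂ} {B : Matrix (Fin n) (Fin n) ℂ} (hA : IsUW 4 A)
    (hB : IsUW 4 B) : IsUW 4 (reindex e e (fromBlocks A 0 0 B)) := by
  constructor
  · intro i j
    simp only [reindex_apply, submatrix_apply]
    rcases e.symm i with i | i <;> rcases e.symm j with j | j
    · exact hA.1 i j
    · exact Or.inl rfl
    · exact Or.inl rfl
    · exact hB.1 i j
  · rw [conjTranspose_reindex, reindex_apply, reindex_apply, submatrix_mul_equiv,
      fromBlocks_conjTranspose, fromBlocks_multiply, hA.2, hB.2]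
    simp only [conjTranspose_zero, Matrix.mul_zero, Matrix.zero_mul, add_zero, zero_add]
    rw [← submatrix_one_equiv e.symm, ← fromBlocks_one]
    ext i j
    simp only [submatrix_apply, Matrix.smul_apply]
    rcases e.symm i with i | i <;> rcases e.symm j with j | j <;> simp

theorem isUW_diagSum : ∀ l : List Block, IsUW 4 (diagSum l)
  | [] => ⟨fun i => i.elim0, by ext i; exact i.elim0⟩
  | b :: l => isUW_reindex_fromBlocks finSumFinEquiv b.isUW (isUW_diagSum l)

theorem isUW_directSum {n : ℕ} (l : List Block) (h : totalOrder l = n) :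
    IsUW 4 (directSum l h) := by
  subst h
  exact isUW_diagSum l

theorem IsUW.transpose {n : ℕ} {W : Matrix (Fin n) (Fin n) ℂ} (h : IsUW 4 W) : IsUW 4 Wᵀ := by
  refine ⟨fun i j => h.1 j i, ?_⟩
  -- a one-sided inverse of a square matrix is two-sided
  have h1 : W * ((4⁻¹ : ℂ) • Wᴴ) = 1 := by
    rw [Matrix.mul_smul, h.2, smul_smul]
    norm_num
  have h2 : Wᴴ * W = (4 : ℂ) • (1 : Matrix (Fin n) (Fin n) ℂ) := by
    rw [← mul_eq_one_comm.1 h1, Matrix.smul_mul, smul_smul]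
    norm_num
  ext i j
  have := congrFun (congrFun h2 j) i
  rw [mul_apply] at this ⊢
  simp only [transpose_apply, conjTranspose_apply, mul_comm (star _)] at this ⊢
  rw [this, Matrix.smul_apply, Matrix.smul_apply, one_apply, one_apply]
  simp [eq_comm]

theorem IsUW.isWeighing {n : ℕ} {W : Matrix (Fin n) (Fin n) ℂ} (h : IsUW 4 W) :
    IsWeighing W := by
  have key : ∀ {W : Matrix (Fin n) (Fin n) ℂ}, IsUW 4 W →
      (∀ i, {j | W i j ≠ 0}.ncard = 4) ∧ ∀ i i', i ≠ i' → ∑ j, W i j * star (W i' j) = 0 := by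
    intro W h
    have e : ∀ i i', ∑ j, W i j * star (W i' j) =
        ((4 : ℕ) : ℂ) * (1 : Matrix (Fin n) (Fin n) ℂ) i i' := fun i i' => by
      simpa [mul_apply] using congrFun (congrFun h.2 i) i'
    refine ⟨fun i => ?_, fun i i' hi => by rw [e, one_apply_ne hi, mul_zero]⟩
    have h1 : ∀ j, W i j * star (W i j) = if W i j ≠ 0 then 1 else 0 := fun j => by
      rcases h.1 i j with h0 | h0
      · simp [h0]
      · rw [if_pos (ne_zero_of_norm h0), mul_star_of_norm h0]
    have h2 := e i i
    rw [Finset.sum_congr rfl fun j _ => h1 j, Finset.sum_boole, one_apply_eq, mul_one] at h2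
    rw [Set.ncard_eq_toFinset_card', Set.toFinset_ofPred]
    exact_mod_cast h2
  exact ⟨h.1, (key h).1, (key h.transpose).1, (key h).2, (key h.transpose).2⟩

/-! ### Decomposition into blocks -/

theorem Similar.cons {ι κ ι' κ' : Type} {b : Block} {l : List Block} {W : Matrix ι κ ℂ}
    {W' : Matrix ι' κ' ℂ} (h : Similar W (Matrix.fromBlocks b.matrix 0 0 W'))
    (h' : Similar W' (diagSum l)) : Similar W (diagSum (b :: l)) :=
  h.trans ((h'.fromBlocks b.matrix).trans (Similar.reindex _ _ _))

theorem IsWeighing.exists_similar_diagSum (n : ℕ) : ∀ {ι κ : Type} [Fintype ι] [Fintype κ]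
    {W : Matrix ι κ ℂ}, IsWeighing W → Fintype.card ι ≤ n → ∃ l, Similar W (diagSum l) := by
  induction n with
  | zero =>
    intro ι κ _ _ W h hn
    have hι : IsEmpty ι := Fintype.card_eq_zero_iff.1 (by omega)
    have hκ : IsEmpty κ := ⟨fun j => by
      obtain ⟨x, -⟩ := exists_supp (h.col_card j)
      exact hι.elim x⟩
    have hnil : IsEmpty (Fin (totalOrder [])) := inferInstanceAs (IsEmpty (Fin 0))
    exact ⟨[], Equiv.equivOfIsEmpty _ _, Equiv.equivOfIsEmpty _ _, 1, 1, by simp, by simp,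
      fun i => i.elim0⟩
  | succ n ih =>
    intro ι κ _ _ W h hn
    rcases isEmpty_or_nonempty ι with hι | hι
    · exact ih h (by simp)
    obtain ⟨b, hb⟩ := h.contains_block
    obtain ⟨ι', κ', _, _, W', hW', hs⟩ := h.exists_similar_fromBlocks b.isUW.isWeighing hb
    have hpos : 0 < b.order := by
      rcases b with _ | _ | _ | _ | ⟨m, hm, x⟩ <;> simp only [Block.order, Block.kind, Kind.order] <;>
        omega
    have hcard : Fintype.card ι' ≤ n := by
      obtain ⟨e, -⟩ := hs
      have := Fintype.card_congr e
      rw [Fintype.card_sum, Fintype.card_fin] at this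
      omega
    obtain ⟨l, hl⟩ := ih hW' hcard
    exact ⟨b :: l, hs.cons hl⟩

theorem similar_diagSum_of_perm {l l' : List Block} (h : l.Perm l') :
    Similar (diagSum l) (diagSum l') := by
  induction h with
  | nil => exact Similar.refl _
  | cons b _ ih => exact Similar.cons (Similar.reindex _ _ _).symm ih
  | swap b b' l =>
    have e := ((Similar.reindex (fromBlocks b.matrix 0 0 (diagSum l)) finSumFinEquiv
      finSumFinEquiv).symm.fromBlocks b'.matrix)
    exact Similar.trans (Similar.reindex _ _ _).symm <| e.trans <|
      (Similar.fromBlocks_swap _ _ _).trans <|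
      ((Similar.reindex _ _ _).fromBlocks b.matrix).trans (Similar.reindex _ _ _)
  | trans _ _ ih ih' => exact ih.trans ih'

theorem equivalent_scaleRows {n : ℕ} (W : Matrix (Fin n) (Fin n) ℂ) (ρ : Fin n → ℂ)
    (hρ : ∀ i, ‖ρ i‖ = 1) : Equivalent W (fun i j => ρ i * W i j) := by
  have key : ∀ s : Finset (Fin n), Equivalent W (fun i j => (if i ∈ s then ρ i else 1) * W i j) := by
    intro s
    induction s using Finset.induction_on with
    | empty =>
      simp only [Finset.notMem_empty, if_false, one_mul]
      exact Relation.ReflTransGen.refl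
    | insert k s hk ih =>
      refine ih.tail ?_
      have st := Step.scaleRow (fun i j => (if i ∈ s then ρ i else 1) * W i j) k
        ⟨ρ k, by simp [Submonoid.unitSphere, hρ]⟩
      refine Eq.subst (motive := Step _) ?_ st
      ext i j
      by_cases hi : i = k
      · subst hi
        exact (congrFun updateRow_self j).trans (by simp [hk])
      · exact (congrFun (updateRow_ne hi) j).trans (by simp [hi])
  simpa using key Finset.univ

theorem equivalent_scaleCols {n : ℕ} (W : Matrix (Fin n) (Fin n) ℂ) (γ : Fin n → ℂ)
    (hγ : ∀ j, ‖γ j‖ = 1) : Equivalent W (fun i j => γ j * W i j) := by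
  have key : ∀ s : Finset (Fin n), Equivalent W (fun i j => (if j ∈ s then γ j else 1) * W i j) := by
    intro s
    induction s using Finset.induction_on with
    | empty =>
      simp only [Finset.notMem_empty, if_false, one_mul]
      exact Relation.ReflTransGen.refl
    | insert k s hk ih =>
      refine ih.tail ?_
      have st := Step.scaleCol (fun i j => (if j ∈ s then γ j else 1) * W i j) k
        ⟨γ k, by simp [Submonoid.unitSphere, hγ]⟩
      refine Eq.subst (motive := Step _) ?_ st
      ext i j
      by_cases hj : j = k
      · subst hj
        exact updateCol_self.trans (by simp [hk])
      · exact (updateCol_ne hj).trans (by simp [hj])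
  simpa using key Finset.univ

theorem Similar.equivalent {n : ℕ} {W W' : Matrix (Fin n) (Fin n) ℂ} (h : Similar W W') :
    Equivalent W W' := by
  obtain ⟨e, f, ρ, γ, hρ, hγ, h⟩ := h
  have h1 : Equivalent W ((W.submatrix e id).submatrix id f) :=
    (Relation.ReflTransGen.single (Step.permRows W e)).tail (Step.permCols _ f)
  refine (h1.trans (equivalent_scaleCols _ γ hγ)).trans ?_
  refine Eq.subst (motive := Equivalent _) ?_ (equivalent_scaleRows _ ρ hρ)
  ext i j
  simp [h, mul_assoc]

theorem Similar.totalOrder_eq {n : ℕ} {W : Matrix (Fin n) (Fin n) ℂ} {l : List Block}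
    (h : Similar W (diagSum l)) : totalOrder l = n := by
  obtain ⟨e, -⟩ := h
  simpa using Fintype.card_congr e

theorem Similar.equivalent_directSum {n : ℕ} {W : Matrix (Fin n) (Fin n) ℂ} {l : List Block}
    (h : Similar W (diagSum l)) : Equivalent W (directSum l h.totalOrder_eq) :=
  (h.trans (Similar.reindex _ _ _)).equivalent

/-! ### Counting decompositions -/

theorem Kind.four_le_order : ∀ k : Kind, 4 ≤ k.order
  | .w5 | .w6 | .w7 | .w8 => by simp [Kind.order]
  | .e m hm => by simp only [Kind.order]; omega

theorem finite_kind_order_le (n : ℕ) : {k : Kind | k.order ≤ n}.Finite := by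
  have : {k : Kind | k.order ≤ n} ⊆ {.w5, .w6, .w7, .w8} ∪
      Set.range fun m : Fin (n + 1) => if hm : 2 ≤ m.val then Kind.e m hm else .w5 := by
    rintro (_ | _ | _ | _ | ⟨m, hm⟩) h
    · simp
    · simp
    · simp
    · simp
    · right
      simp only [Set.mem_ofPred_eq, Kind.order] at h
      exact ⟨⟨m, by omega⟩, by simp [hm]⟩
  exact (Set.toFinite _).subset this

instance finite_decomposition (n : ℕ) : Finite (Decomposition n) := by
  classical
  obtain ⟨K, hK⟩ := (finite_kind_order_le n).exists_finset_coe
  have : {s : Multiset Kind | (s.map Kind.order).sum = n} ⊆ Set.Iic (n • K.val) := by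
    intro s hs
    rw [Set.mem_ofPred_eq] at hs
    -- each kind has order at most `n`, and no kind occurs more than `n` times
    rw [Set.mem_Iic, Multiset.le_iff_count]
    intro k
    by_cases hk : k ∈ s
    · have h1 : k.order ≤ n := hs ▸ Multiset.single_le_sum (by simp) _ (Multiset.mem_map_of_mem _ hk)
      have h2 : k ∈ K := by
        rw [← Finset.mem_coe, hK]
        exact h1
      have h3 : s.card ≤ n := by
        have := Multiset.card_nsmul_le_sum (s := s.map Kind.order) (a := 1) (by
          intro x hx
          obtain ⟨k, -, rfl⟩ := Multiset.mem_map.1 hx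
          have := k.four_le_order
          omega)
        simpa [hs] using this
      rw [Multiset.count_nsmul, Multiset.count_eq_one_of_mem K.nodup h2, mul_one]
      exact (Multiset.count_le_card k s).trans h3
    · simp [Multiset.count_eq_zero_of_notMem hk]
  exact Set.Finite.to_subtype ((Set.finite_Iic _).subset this)

theorem totalOrder_eq_sum (l : List Block) :
    totalOrder l = (((l.map Block.kind : List Kind) : Multiset Kind).map Kind.order).sum := by
  induction l with
  | nil => rfl
  | cons b l ih => simpa [totalOrder, Block.order] using ih

/-- The decomposition of the total order given by the kinds of the blocks of a list. -/
def decompositionOf {n : ℕ} (l : List Block) (h : totalOrder l = n) : Decomposition n :=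
  ⟨(l.map Block.kind : List Kind), by rw [← totalOrder_eq_sum, h]⟩

/-- The kinds of a decomposition, in a fixed but arbitrary order. -/
def Decomposition.kinds {n : ℕ} (d : Decomposition n) : List Kind := d.1.toList

/-- A block of a given kind; the parameter of `E` is taken to be `1`. -/
def Kind.block : Kind → Block
  | .w5 => .w5
  | .w6 => .w6
  | .w7 => .w7
  | .w8 => .w8
  | .e m hm => .e m hm 1

theorem Kind.kind_block : ∀ k : Kind, k.block.kind = k
  | .w5 | .w6 | .w7 | .w8 => rfl
  | .e _ _ => rfl

theorem Decomposition.map_kind {n : ℕ} (d : Decomposition n) :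
    (d.kinds.map Kind.block).map Block.kind = d.kinds := by
  simp [Function.comp_def, Kind.kind_block]

theorem Decomposition.totalOrder_eq {n : ℕ} (d : Decomposition n) :
    totalOrder (d.kinds.map Kind.block) = n := by
  rw [totalOrder_eq_sum, d.map_kind, kinds, Multiset.coe_toList, d.2]

/-- Every `UW(n, 4)` is equivalent to a direct sum of blocks whose kinds are those of a
decomposition, in the order fixed for this decomposition. -/
theorem IsUW.exists_decomposition {n : ℕ} {W : Matrix (Fin n) (Fin n) ℂ} (hW : IsUW 4 W) :
    ∃ (d : Decomposition n) (l : List Block) (h : totalOrder l = n),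
      l.map Block.kind = d.kinds ∧ Equivalent W (directSum l h) := by
  obtain ⟨l, hl⟩ := hW.isWeighing.exists_similar_diagSum _ le_rfl
  let d := decompositionOf l hl.totalOrder_eq
  have hp : (l.map Block.kind).Perm d.kinds := by
    rw [← Multiset.coe_eq_coe, Decomposition.kinds, Multiset.coe_toList]
    rfl
  obtain ⟨l', hk, hll'⟩ : Relation.Comp (fun u v => u = List.map Block.kind v) List.Perm d.kinds l := by
    rw [List.eq_map_comp_perm]
    exact hp.symm
  have hs := hl.trans (similar_diagSum_of_perm hll'.symm)
  exact ⟨d, l', hs.totalOrder_eq, hk.symm, hs.equivalent_directSum⟩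

/-- Orders from four to seven are those of single blocks; larger ones are reached by adding copies of
`E 2 1`. -/
theorem exists_totalOrder (n : ℕ) (hn : 4 ≤ n) : ∃ l : List Block, totalOrder l = n := by
  induction n using Nat.strong_induction_on with
  | _ n ih =>
    by_cases h8 : 8 ≤ n
    · obtain ⟨l, hl⟩ := ih (n - 4) (by omega) (by omega)
      refine ⟨.e 2 le_rfl 1 :: l, ?_⟩
      simp only [totalOrder, Block.order, Block.kind, Kind.order, hl]
      omega
    · interval_cases n
      exacts [⟨[.e 2 le_rfl 1], rfl⟩, ⟨[.w5], rfl⟩, ⟨[.w6], rfl⟩, ⟨[.w7], rfl⟩]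

/-- The class of the direct sums of blocks with the kinds of a decomposition. -/
def Decomposition.familyClass {n : ℕ} (d : Decomposition n) : Quotient (familySetoid n) :=
  ⟦⟨directSum _ d.totalOrder_eq, isUW_directSum _ _⟩⟧

theorem Decomposition.familyClass_surjective (n : ℕ) :
    Function.Surjective (Decomposition.familyClass (n := n)) := by
  intro q
  induction q using Quotient.inductionOn with
  | _ W =>
    obtain ⟨d, l, h, hk, hW⟩ := W.2.exists_decomposition
    refine ⟨d, Quotient.sound (Relation.EqvGen.symm _ _ ?_)⟩
    refine Relation.EqvGen.trans _ ⟨directSum l h, isUW_directSum l h⟩ _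
      (Relation.EqvGen.rel _ _ (Or.inl hW)) (Relation.EqvGen.rel _ _ (Or.inr ?_))
    exact ⟨l, _, h, d.totalOrder_eq, by rw [hk, d.map_kind], rfl, rfl⟩

end

end UnitWeighing

end

open UnitWeighing in
theorem mainTheorem1 :
    -- every direct sum of the blocks is a unit weighing matrix of weight 4
    (∀ (n : ℕ) (l : List Block) (h : totalOrder l = n), IsUW 4 (directSum l h)) ∧
    -- every `UW(n, 4)` is equivalent to a direct sum of the blocks
    (∀ (n : ℕ) (W : Matrix (Fin n) (Fin n) ℂ), IsUW 4 W →
      ∃ (l : List Block) (h : totalOrder l = n), Equivalent W (directSum l h)) ∧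
    -- a `UW(n, 4)` exists for every `n ≥ 4`
    (∀ n : ℕ, 4 ≤ n → ∃ W : Matrix (Fin n) (Fin n) ℂ, IsUW 4 W) ∧
    -- the number of inequivalent `UW(n, 4)`, the unimodular parameters being left free
    (∀ n : ℕ, Finite (Decomposition n) ∧
      (∃ F : Finset (List Kind), F.card ≤ Nat.card (Decomposition n) ∧
        ∀ W : Matrix (Fin n) (Fin n) ℂ, IsUW 4 W →
          ∃ (l : List Block) (h : totalOrder l = n),
            l.map Block.kind ∈ F ∧ Equivalent W (directSum l h)) ∧
      Finite (Quotient (familySetoid n)) ∧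
      Nat.card (Quotient (familySetoid n)) ≤ Nat.card (Decomposition n)) := by
  classical
  refine ⟨fun n l h => isUW_directSum l h, fun n W hW => ?_, fun n hn => ?_, fun n => ?_⟩
  · obtain ⟨-, l, h, -, hl⟩ := hW.exists_decomposition
    exact ⟨l, h, hl⟩
  · obtain ⟨l, h⟩ := exists_totalOrder n hn
    exact ⟨_, isUW_directSum l h⟩
  · have := Fintype.ofFinite (Decomposition n)
    refine ⟨inferInstance, ⟨Finset.univ.image (Decomposition.kinds (n := n)), ?_, fun W hW => ?_⟩,
      Finite.of_surjective _ (Decomposition.familyClass_surjective n),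
      Nat.card_le_card_of_surjective _ (Decomposition.familyClass_surjective n)⟩
    · rw [Nat.card_eq_fintype_card]
      exact Finset.card_image_le
    · obtain ⟨d, l, h, hk, hl⟩ := hW.exists_decomposition
      exact ⟨l, h, by simp [hk], hl⟩
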